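/- Let $M$ be a smooth manifold and $\eta$ a pre-symplectic form of rank $k$ on $M$, i.e. a smooth closed 2-form such that $\eta^\sharp\colon TM\to T^*M,\ v\mapsto\eta(v,\cdot)$ has constant rank $k$. Put $K=\ker\eta^\sharp$ and let $G\subset TM$ be a smooth subbundle with $TM=K\oplus G$. Notation. For a bivector field $Z$ let $Z^\sharp\xi=Z(\xi,\cdot)$, let $\iota_Z$ be the contraction of forms with $\iota_{X\wedge Y}=\iota_X\iota_Y$, let $\mathcal L_Z=\iota_Z d-d\,\iota_Z$, and let $[Z,Z]$ be the Schouten bracket (so $[X\wedge Y,X\wedge Y]=2\,X\wedge Y\wedge[X,Y]$). On $\Omega(M)[2]$ consider the brackets $$\lambda_1=d,\qquad \lambda_2(\alpha,\beta)=-\big(\mathcal L_Z(\alpha\wedge\beta)-\mathcal L_Z\alpha\wedge\beta-(-1)^{|\alpha|}\alpha\wedge\mathcal L_Z\beta\big),\qquad \lambda_3(\alpha,\beta,\gamma)=(-1)^{|\beta|+1}(\alpha^\sharp\wedge\beta^\sharp\wedge\gamma^\sharp)\big(\tfrac12[Z,Z]\big),$$ where $(\alpha^\sharp\wedge\beta^\sharp\wedge\gamma^\sharp)(v_1\wedge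 v_2\wedge v_3)=\sum_{\sigma\in S_3}(-1)^{|\sigma|}\,\iota_{v_{\sigma(1)}}\alpha\wedge\iota_{v_{\sigma(2)}}\beta\wedge\iota_{v_{\sigma(3)}}\gamma$. Let $\Omega_{\mathrm{hor}}(M)$ be the space of smooth forms whose restriction to $K$ vanishes; with the restricted brackets, $\Omega_{\mathrm{hor}}(M)[2]$ is the Koszul $L_\infty[1]$-algebra of $(M,\eta)$ when $Z$ is the bivector field given in part 1 below. Its set $\mathsf{MC}(\eta)$ of Maurer–Cartan elements consists of the $\beta\in\Omega^2_{\mathrm{hor}}(M)$ with $\lambda_1(\beta)+\tfrac12\lambda_2(\beta,\beta)+\tfrac16\lambda_3(\beta,\beta,\beta)=0$. Let $\Gamma(\mathcal I_Z)$ be the set of smooth 2-forms $\beta$ with $\mathrm{id}+Z^\sharp\beta^\sharp$ invertible at every point, and for such $\beta$ let $\exp_\eta(\beta)=\eta+F(\beta)$, where $F(\beta)^\sharp=\beta^\sharp(\mathrm{id}+Z^\sharp\beta^\sharp)^{-1}$. Theorem. 1. There is a unique bivector field $Z$ on $M$ with $Z^\sharp=-(\eta|_G^\sharp)^{-1}$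 (a map $G^*\to G$, extended to $T^*M\to TM$ by restriction $T^*M\to G^*$ and inclusion $G\subset TM$), and it is smooth. 2. With this $Z$, for every $\beta\in\Gamma(\mathcal I_Z)$: $\beta$ is a Maurer–Cartan element of the Koszul $L_\infty[1]$-algebra $\Omega_{\mathrm{hor}}(M)[2]$ if and only if $\exp_\eta(\beta)$ is a pre-symplectic form of rank $k$. 3. With this $Z$, $\exp_\eta$ restricts to a bijection from $\Gamma(\mathcal I_Z)\cap\mathsf{MC}(\eta)$ onto the set of pre-symplectic forms $\eta'$ of rank $k$ on $M$ such that $TM=\ker(\eta')\oplus G$. -/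

import Mathlib

open scoped Manifold ContDiff

noncomputable section

namespace PreSymplectic

/-! ### Linear algebra of forms and multivectors on one vector space

A `k`-form on `V` is an alternating map `V [⋀^Fin k]→ₗ[ℝ] ℝ`.  For finite-dimensional `V` a
`p`-vector, i.e. an element of `⋀ᵖ V`, is identified with an alternating `p`-form on the dual
space: `v₁ ∧ ⋯ ∧ vₚ` is the form `(ξ₁, …, ξₚ) ↦ det (ξᵢ vⱼ)`. -/

section LinearAlgebra

variable {V : Type*} [AddCommGroup V] [Module ℝ V]

/-- A `p`-vector on `V`, as an alternating form on the dual space. -/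
abbrev MultiVector (p : ℕ) (V : Type*) [AddCommGroup V] [Module ℝ V] : Type _ :=
  Module.Dual ℝ V [⋀^Fin p]→ₗ[ℝ] ℝ

/-- The linear map `V → V*`, `v ↦ α (v, ·)`, of a two-form `α`. -/
def flat (α : V [⋀^Fin 2]→ₗ[ℝ] ℝ) : V →ₗ[ℝ] Module.Dual ℝ V :=
  LinearMap.mk₂ ℝ (fun u v => α ![u, v])
    (fun u u' v => α.map_vecCons_add ![v] u u')
    (fun c u v => α.map_vecCons_smul ![v] c u)
    (fun u v v' => (α.curryLeft u).map_vecCons_add ![] v v')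
    (fun c u v => (α.curryLeft u).map_vecCons_smul ![] c v)

@[simp] theorem flat_apply (α : V [⋀^Fin 2]→ₗ[ℝ] ℝ) (u v : V) : flat α u v = α ![u, v] := rfl

/-- The linear map `Z♯ : V* → V`, `ξ ↦ Z (ξ, ·)`, of a bivector `Z`; here `V** = V`. -/
def sharp [FiniteDimensional ℝ V] (Z : MultiVector 2 V) : Module.Dual ℝ V →ₗ[ℝ] V :=
  (Module.evalEquiv ℝ V).symm.toLinearMap ∘ₗ flat Z

theorem apply_sharp [FiniteDimensional ℝ V] (Z : MultiVector 2 V) (ξ ζ : Module.Dual ℝ V) :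
    ζ (sharp Z ξ) = Z ![ξ, ζ] := by
  have h : Module.evalEquiv ℝ V (sharp Z ξ) = flat Z ξ := by simp [sharp]
  exact congrArg (fun f => f ζ) h

/-- The two-form with a given alternating bilinear form. -/
def ofIsAlt (B : V →ₗ[ℝ] V →ₗ[ℝ] ℝ) (hB : B.IsAlt) : V [⋀^Fin 2]→ₗ[ℝ] ℝ where
  toFun v := B (v 0) (v 1)
  map_update_add' := by
    intro _ m i x y
    fin_cases i <;> simp [Function.update]
  map_update_smul' := by
    intro _ m i c x
    fin_cases i <;> simp [Function.update]
  map_eq_zero_of_eq' := by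
    intro v i j hv hij
    have h : v 0 = v 1 := by
      fin_cases i <;> fin_cases j <;> simp_all
    rw [h]
    exact hB (v 1)

/-- Reindexing along an equality of degrees.  It is `0` when the degrees differ, which below only
happens for expressions of negative degree (such as the Koszul bracket of two functions). -/
def reindex {a : ℕ} (b : ℕ) (α : V [⋀^Fin a]→ₗ[ℝ] ℝ) : V [⋀^Fin b]→ₗ[ℝ] ℝ :=
  if h : a = b then α.domDomCongr (finCongr h) else 0

/-- The wedge product of forms,
`(α ∧ β)(v₁, …, vₚ₊ᵩ) = ∑ sign(σ) α (v_σ(1), …) β (v_σ(p+1), …)`, over `(p, q)`-shuffles `σ`. -/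
def wedge {p q : ℕ} (α : V [⋀^Fin p]→ₗ[ℝ] ℝ) (β : V [⋀^Fin q]→ₗ[ℝ] ℝ) :
    V [⋀^Fin (p + q)]→ₗ[ℝ] ℝ :=
  ((LinearMap.mul' ℝ ℝ).compAlternatingMap (α.domCoprod β)).domDomCongr finSumFinEquiv

/-- The interior product `ι_v α = α (v, ·, …, ·)`; it vanishes on forms of degree `0`. -/
def interior (v : V) : {k : ℕ} → (V [⋀^Fin k]→ₗ[ℝ] ℝ) → V [⋀^Fin (k - 1)]→ₗ[ℝ] ℝ
  | 0, _ => 0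
  | _ + 1, α => α.curryLeft v

/-- The contraction `ι_Z` of a form with a bivector, determined by `ι_{X ∧ Y} = ι_X ∘ ι_Y`:
for a basis `e` one has `Z = ½ ∑ Zⁱʲ eᵢ ∧ eⱼ` with `Zⁱʲ = Z (eⁱ, eʲ)`. -/
def contract [FiniteDimensional ℝ V] (Z : MultiVector 2 V) {k : ℕ}
    (α : V [⋀^Fin (k + 2)]→ₗ[ℝ] ℝ) : V [⋀^Fin k]→ₗ[ℝ] ℝ :=
  let e := Module.finBasis ℝ V
  (1 / 2 : ℝ) • ∑ i, ∑ j,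
    Z ![e.coord i, e.coord j] • (α.curryLeft (e j)).curryLeft (e i)

/-- `(α♯ ∧ β♯ ∧ γ♯)(v₁ ∧ v₂ ∧ v₃) = ∑_σ sign(σ) ι_{v_σ(1)} α ∧ ι_{v_σ(2)} β ∧ ι_{v_σ(3)} γ`. -/
def sharpWedge {r s t : ℕ} (α : V [⋀^Fin r]→ₗ[ℝ] ℝ) (β : V [⋀^Fin s]→ₗ[ℝ] ℝ)
    (γ : V [⋀^Fin t]→ₗ[ℝ] ℝ) (v : Fin 3 → V) : V [⋀^Fin (r + s + t - 3)]→ₗ[ℝ] ℝ :=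
  reindex (r + s + t - 3) (∑ σ : Equiv.Perm (Fin 3), ((Equiv.Perm.sign σ : ℤ) : ℝ) •
    wedge (wedge (interior (v (σ 0)) α) (interior (v (σ 1)) β)) (interior (v (σ 2)) γ))

/-- The linear extension `(α♯ ∧ β♯ ∧ γ♯)(T)` of `sharpWedge` to trivectors
`T = ⅙ ∑ Tⁱʲᵏ eᵢ ∧ eⱼ ∧ eₖ`. -/
def sharpWedgeTri [FiniteDimensional ℝ V] {r s t : ℕ} (α : V [⋀^Fin r]→ₗ[ℝ] ℝ)
    (β : V [⋀^Fin s]→ₗ[ℝ] ℝ) (γ : V [⋀^Fin t]→ₗ[ℝ] ℝ) (T : MultiVector 3 V) :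
    V [⋀^Fin (r + s + t - 3)]→ₗ[ℝ] ℝ :=
  let e := Module.finBasis ℝ V
  (1 / 6 : ℝ) • ∑ i, ∑ j, ∑ k,
    T ![e.coord i, e.coord j, e.coord k] • sharpWedge α β γ ![e i, e j, e k]

/-- The endomorphism `id + Z♯ β♯` of `V`. -/
def idAdd [FiniteDimensional ℝ V] (Z : MultiVector 2 V) (β : V [⋀^Fin 2]→ₗ[ℝ] ℝ) :
    Module.End ℝ V :=
  LinearMap.id + sharp Z ∘ₗ flat β

/-- The set `I_Z` of two-forms `β` for which `id + Z♯ β♯` is invertible. -/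
def IZ [FiniteDimensional ℝ V] (Z : MultiVector 2 V) : Set (V [⋀^Fin 2]→ₗ[ℝ] ℝ) :=
  {β | IsUnit (idAdd Z β)}

/-- The linear map `β♯ (id + Z♯ β♯)⁻¹ : V → V*`. -/
def FFlat [FiniteDimensional ℝ V] (Z : MultiVector 2 V) (β : V [⋀^Fin 2]→ₗ[ℝ] ℝ) :
    V →ₗ[ℝ] Module.Dual ℝ V :=
  flat β ∘ₗ Ring.inverse (idAdd Z β)

theorem isAlt_FFlat [FiniteDimensional ℝ V] (Z : MultiVector 2 V) (β : V [⋀^Fin 2]→ₗ[ℝ] ℝ) :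
    (FFlat Z β).IsAlt := by
  intro v
  by_cases h : IsUnit (idAdd Z β)
  · obtain ⟨u, rfl⟩ : ∃ u, v = idAdd Z β u :=
      ⟨Ring.inverse (idAdd Z β) v, by
        rw [← Module.End.mul_apply, Ring.mul_inverse_cancel _ h]; rfl⟩
    have h1 : Ring.inverse (idAdd Z β) (idAdd Z β u) = u := by
      rw [← Module.End.mul_apply, Ring.inverse_mul_cancel _ h]; rfl
    have h2 : flat β u u = 0 :=
      β.map_eq_zero_of_eq ![u, u] (i := 0) (j := 1) rfl (by decide)
    have h3 : flat β u (sharp Z (flat β u)) = 0 := by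
      rw [apply_sharp]
      exact Z.map_eq_zero_of_eq _ (i := 0) (j := 1) rfl (by decide)
    have h4 : idAdd Z β u = u + sharp Z (flat β u) := rfl
    rw [FFlat, LinearMap.comp_apply, h1, h4, map_add, h2, h3, add_zero]
  · simp [FFlat, Ring.inverse_non_unit _ h]

/-- The map `F`, determined on `I_Z` by `(F β)♯ = β♯ (id + Z♯ β♯)⁻¹`. -/
def F [FiniteDimensional ℝ V] (Z : MultiVector 2 V) (β : V [⋀^Fin 2]→ₗ[ℝ] ℝ) :
    V [⋀^Fin 2]→ₗ[ℝ] ℝ :=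
  ofIsAlt (FFlat Z β) (isAlt_FFlat Z β)

/-- The Dirac exponential map `exp_η (β) = η + F (β)`. -/
def diracExp [FiniteDimensional ℝ V] (η : V [⋀^Fin 2]→ₗ[ℝ] ℝ) (Z : MultiVector 2 V)
    (β : V [⋀^Fin 2]→ₗ[ℝ] ℝ) : V [⋀^Fin 2]→ₗ[ℝ] ℝ :=
  η + F Z β

/-- `Z♯ = -(η|_G♯)⁻¹`, where `η|_G♯ : G → G*` and `Z♯` is regarded as the composition
`V* → G* → G ⊆ V`: whenever `ξ|_G = η (g, ·)|_G` with `g ∈ G`, then `Z♯ ξ = -g`. -/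
def IsNegInverse [FiniteDimensional ℝ V] (η : V [⋀^Fin 2]→ₗ[ℝ] ℝ) (G : Submodule ℝ V)
    (Z : MultiVector 2 V) : Prop :=
  ∀ ξ : Module.Dual ℝ V, ∀ g ∈ G, (∀ w ∈ G, ξ w = η ![g, w]) → sharp Z ξ = -g

/-- In finite dimension alternating maps are continuous. -/
theorem continuous_alternating {W : Type*} [NormedAddCommGroup W] [NormedSpace ℝ W]
    [FiniteDimensional ℝ W] {k : ℕ} (α : W [⋀^Fin k]→ₗ[ℝ] ℝ) : Continuous α := by
  classical
  let b := Module.finBasis ℝ W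
  have h : (α : (Fin k → W) → ℝ) = fun v => ∑ r : Fin k → Fin (Module.finrank ℝ W),
      (∏ i, b.coord (r i) (v i)) • α (fun i => b (r i)) := by
    funext v
    have hv : v = fun i => ∑ j, b.coord j (v i) • b j := by
      funext i
      exact (b.sum_repr (v i)).symm
    conv_lhs => rw [hv]
    have h1 := α.toMultilinearMap.map_sum (fun i j => b.coord j (v i) • b j)
    have h2 : ∀ r : Fin k → Fin (Module.finrank ℝ W),
        α.toMultilinearMap (fun i => b.coord (r i) (v i) • b (r i)) =
          (∏ i, b.coord (r i) (v i)) • α (fun i => b (r i)) :=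
      fun r => α.toMultilinearMap.map_smul_univ _ _
    exact h1.trans (Finset.sum_congr rfl fun r _ => h2 r)
  rw [h]
  refine continuous_finsetSum _ fun r _ => Continuous.mul ?_ continuous_const
  refine continuous_finsetProd _ fun i _ => ?_
  exact (LinearMap.continuous_of_finiteDimensional (b.coord (r i))).comp (continuous_apply i)

/-- An alternating map on a finite-dimensional normed space as a continuous alternating map. -/
def toContinuousAlternating {W : Type*} [NormedAddCommGroup W] [NormedSpace ℝ W]
    [FiniteDimensional ℝ W] {k : ℕ} (α : W [⋀^Fin k]→ₗ[ℝ] ℝ) : W [⋀^Fin k]→L[ℝ] ℝ :=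
  { α with cont := continuous_alternating α }

end LinearAlgebra

/-! ### Differential forms and multivector fields on a manifold -/

section Manifold

variable {E : Type*} [NormedAddCommGroup E] [NormedSpace ℝ E]
  {M : Type*} [TopologicalSpace M] [ChartedSpace E M]

instance instFiniteDimensionalTangentSpace [FiniteDimensional ℝ E] (x : M) :
    FiniteDimensional ℝ (TangentSpace 𝓘(ℝ, E) x) :=
  inferInstanceAs (FiniteDimensional ℝ E)

variable (E M) in
/-- A (not necessarily smooth) differential `k`-form on `M`. -/
abbrev FormField (k : ℕ) : Type _ := ∀ x : M, TangentSpace 𝓘(ℝ, E) x [⋀^Fin k]→ₗ[ℝ] ℝ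

variable (E M) in
/-- A (not necessarily smooth) field of `p`-vectors on `M`. -/
abbrev MultiVectorField (p : ℕ) : Type _ := ∀ x : M, MultiVector p (TangentSpace 𝓘(ℝ, E) x)

variable (E M) in
/-- A (not necessarily smooth) field of subspaces of the tangent spaces of `M`. -/
abbrev TangentDistribution : Type _ := ∀ x : M, Submodule ℝ (TangentSpace 𝓘(ℝ, E) x)

/-- The differential at `x` of the chart around `x₀`. -/
def chartDeriv (x₀ x : M) : TangentSpace 𝓘(ℝ, E) x →L[ℝ] E :=
  (NormedSpace.fromTangentSpace (𝕜 := ℝ) (chartAt E x₀ x)).toContinuousLinearMap.comp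
    (mfderiv 𝓘(ℝ, E) 𝓘(ℝ, E) (chartAt E x₀) x)

/-- The differential at `y` of the inverse of the chart around `x₀`. -/
def chartSymmDeriv (x₀ : M) (y : E) : E →L[ℝ] TangentSpace 𝓘(ℝ, E) ((chartAt E x₀).symm y) :=
  (mfderiv 𝓘(ℝ, E) 𝓘(ℝ, E) (chartAt E x₀).symm y).comp
    (NormedSpace.fromTangentSpace (𝕜 := ℝ) y).symm.toContinuousLinearMap

variable [FiniteDimensional ℝ E]

/-- The expression of a form in the chart around `x₀`: its pullback by the inverse of the chart. -/
def FormField.inChart {k : ℕ} (α : FormField E M k) (x₀ : M) (y : E) : E [⋀^Fin k]→L[ℝ] ℝ :=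
  toContinuousAlternating
    ((α ((chartAt E x₀).symm y)).compLinearMap (chartSymmDeriv x₀ y).toLinearMap)

/-- A form is smooth if its expressions in charts are. -/
def FormField.IsSmooth {k : ℕ} (α : FormField E M k) : Prop :=
  ∀ x₀ : M, ContDiffOn ℝ ∞ (α.inChart x₀) (chartAt E x₀).target

/-- The de Rham differential, computed at `x` in the chart around `x`. -/
def FormField.d {k : ℕ} (α : FormField E M k) : FormField E M (k + 1) := fun x =>
  (extDeriv (α.inChart x) (chartAt E x x)).toAlternatingMap.compLinearMap
    (chartDeriv x x).toLinearMap

/-- The expression of a multivector field in the chart around `x₀`: its push-forward by the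
chart. -/
def MultiVectorField.inChart {p : ℕ} (P : MultiVectorField E M p) (x₀ : M) (y : E) :
    (E →L[ℝ] ℝ) [⋀^Fin p]→L[ℝ] ℝ :=
  toContinuousAlternating ((P ((chartAt E x₀).symm y)).compLinearMap
    ((chartDeriv x₀ ((chartAt E x₀).symm y)).toLinearMap.dualMap ∘ₗ ContinuousLinearMap.coeLM ℝ))

/-- A multivector field is smooth if its expressions in charts are. -/
def MultiVectorField.IsSmooth {p : ℕ} (P : MultiVectorField E M p) : Prop :=
  ∀ x₀ : M, ContDiffOn ℝ ∞ (P.inChart x₀) (chartAt E x₀).target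

/-- A distribution is a smooth subbundle of the tangent bundle if it has smooth local frames. -/
def TangentDistribution.IsSmooth [IsManifold 𝓘(ℝ, E) ∞ M] (G : TangentDistribution E M) : Prop :=
  ∀ x₀ : M, ∃ U : Set M, IsOpen U ∧ x₀ ∈ U ∧
    ∃ (r : ℕ) (X : Fin r → ∀ x : M, TangentSpace 𝓘(ℝ, E) x),
      (∀ i, ContMDiffOn 𝓘(ℝ, E) 𝓘(ℝ, E).tangent ∞
        (fun x => (⟨x, X i x⟩ : TangentBundle 𝓘(ℝ, E) M)) U) ∧
      ∀ x ∈ U, LinearIndependent ℝ (fun i => X i x) ∧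
        Submodule.span ℝ (Set.range fun i => X i x) = G x

/-- For bivector fields `P`, `Q` on the vector space `E`, at the point `y`, the linear map
`ξ ↦ D_{P♯ ξ} Q` on covectors. -/
def bivectorDeriv (P Q : E → (E →L[ℝ] ℝ) [⋀^Fin 2]→L[ℝ] ℝ) (y : E) :
    (E →L[ℝ] ℝ) →ₗ[ℝ] (E →L[ℝ] ℝ) [⋀^Fin 2]→ₗ[ℝ] ℝ :=
  ContinuousAlternatingMap.toAlternatingMapLinear (R := ℝ) ∘ₗ (fderiv ℝ Q y).toLinearMap ∘ₗ
    sharp ((P y).toAlternatingMap.compLinearMap LinearMap.toContinuousLinearMap.toLinearMap) ∘ₗ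
    ContinuousLinearMap.coeLM ℝ

/-- The Schouten bracket of two bivector fields on the vector space `E`.  In coordinates
`[P, Q]ⁱʲᵏ = ∑_l (Pⁱˡ ∂ₗ Qʲᵏ + Qⁱˡ ∂ₗ Pʲᵏ) +` cyclic permutations of `i, j, k`; for instance
`[X ∧ Y, X ∧ Y] = 2 X ∧ Y ∧ [X, Y]`. -/
def schoutenE (P Q : E → (E →L[ℝ] ℝ) [⋀^Fin 2]→L[ℝ] ℝ) (y : E) :
    (E →L[ℝ] ℝ) [⋀^Fin 3]→ₗ[ℝ] ℝ :=
  AlternatingMap.alternatizeUncurryFin (bivectorDeriv P Q y + bivectorDeriv Q P y)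

/-- The Schouten bracket `[P, Q]` of two bivector fields on `M`, computed at `x` in the chart
around `x`. -/
def schouten (P Q : MultiVectorField E M 2) : MultiVectorField E M 3 := fun x =>
  (schoutenE (P.inChart x) (Q.inChart x) (chartAt E x x)).compLinearMap
    (LinearMap.toContinuousLinearMap.toLinearMap ∘ₗ
      (chartDeriv x x).inverse.toLinearMap.dualMap)

/-! ### The Koszul brackets of a bivector field -/

/-- The contraction `ι_Z α` of a form with a bivector field; `ι_Z` vanishes in degrees `0, 1`. -/
def FormField.contract (Z : MultiVectorField E M 2) {k : ℕ} (α : FormField E M (k + 2)) :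
    FormField E M k :=
  fun x => PreSymplectic.contract (Z x) (α x)

/-- The wedge product of differential forms. -/
def FormField.wedge {r s : ℕ} (α : FormField E M r) (β : FormField E M s) :
    FormField E M (r + s) :=
  fun x => PreSymplectic.wedge (α x) (β x)

/-- Reindexing along an equality of degrees (`0` if the degrees differ). -/
def FormField.reindex {r : ℕ} (s : ℕ) (α : FormField E M r) : FormField E M s :=
  fun x => PreSymplectic.reindex s (α x)

/-- The operator `L_Z = ι_Z ∘ d - d ∘ ι_Z`, which lowers the degree by one. -/
def lieBivector (Z : MultiVectorField E M 2) :
    {k : ℕ} → FormField E M k → FormField E M (k - 1)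
  | 0, _ => 0
  | 1, α => α.d.contract Z
  | _ + 2, α => α.d.contract Z - (α.contract Z).d

/-- The Koszul bracket
`[α, β]_Z = (-1)^(|α|+1) (L_Z (α ∧ β) - L_Z α ∧ β - (-1)^|α| α ∧ L_Z β)`. -/
def koszulBracket (Z : MultiVectorField E M 2) {r s : ℕ} (α : FormField E M r)
    (β : FormField E M s) : FormField E M (r + s - 1) :=
  (-1 : ℝ) ^ (r + 1) • (lieBivector Z (α.wedge β) -
    ((lieBivector Z α).wedge β).reindex (r + s - 1) -
    (-1 : ℝ) ^ r • (α.wedge (lieBivector Z β)).reindex (r + s - 1))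

/-- The trinary bracket `[α, β, γ]_Z = (α♯ ∧ β♯ ∧ γ♯) (½ [Z, Z])`. -/
def trinaryBracket (Z : MultiVectorField E M 2) {r s t : ℕ} (α : FormField E M r)
    (β : FormField E M s) (γ : FormField E M t) : FormField E M (r + s + t - 3) :=
  fun x => sharpWedgeTri (α x) (β x) (γ x) ((1 / 2 : ℝ) • schouten Z Z x)

/-- The unary bracket `λ₁ = d` on `Ω(M)[2]`. -/
def lambda₁ {r : ℕ} (α : FormField E M r) : FormField E M (r + 1) := α.d

/-- The binary bracket `λ₂ (α, β) = (-1)^|α| [α, β]_Z` on `Ω(M)[2]`. -/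
def lambda₂ (Z : MultiVectorField E M 2) {r s : ℕ} (α : FormField E M r) (β : FormField E M s) :
    FormField E M (r + s - 1) :=
  (-1 : ℝ) ^ r • koszulBracket Z α β

/-- The trinary bracket `λ₃ (α, β, γ) = (-1)^(|β|+1) [α, β, γ]_Z` on `Ω(M)[2]`. -/
def lambda₃ (Z : MultiVectorField E M 2) {r s t : ℕ} (α : FormField E M r) (β : FormField E M s)
    (γ : FormField E M t) : FormField E M (r + s + t - 3) :=
  (-1 : ℝ) ^ (s + 1) • trinaryBracket Z α β γ

/-! ### Pre-symplectic forms and Maurer–Cartan elements -/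

/-- The field of kernels of a two-form. -/
def kernel (η : FormField E M 2) : TangentDistribution E M := fun x => LinearMap.ker (flat (η x))

/-- `η` is a pre-symplectic form of rank `k`: smooth, closed and of constant rank `k`. -/
structure IsPreSymplectic (η : FormField E M 2) (k : ℕ) : Prop where
  isSmooth : η.IsSmooth
  closed : η.d = 0
  rank : ∀ x, Module.finrank ℝ (LinearMap.range (flat (η x))) = k

/-- Horizontal forms: those whose restriction to the kernel of `η` vanishes. -/
def IsHorizontal (η : FormField E M 2) {k : ℕ} (α : FormField E M k) : Prop :=
  ∀ x, ∀ v : Fin k → TangentSpace 𝓘(ℝ, E) x, (∀ i, v i ∈ kernel η x) → α x v = 0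

/-- The set `MC(η)` of Maurer–Cartan elements of the Koszul algebra `Ω_hor(M)[2]`, whose brackets
are the restrictions of `λ₁`, `λ₂`, `λ₃`. -/
def MC (η : FormField E M 2) (Z : MultiVectorField E M 2) : Set (FormField E M 2) :=
  {β | β.IsSmooth ∧ IsHorizontal η β ∧
    lambda₁ β + (1 / 2 : ℝ) • (lambda₂ Z β β : FormField E M 3) +
      (1 / 6 : ℝ) • (lambda₃ Z β β β : FormField E M 3) = 0}

/-- The set `Γ(I_Z)` of smooth two-forms with values in `I_Z`. -/
def sectionsIZ (Z : MultiVectorField E M 2) : Set (FormField E M 2) :=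
  {β | β.IsSmooth ∧ ∀ x, β x ∈ IZ (Z x)}

/-- The Dirac exponential map on sections. -/
def expη (η : FormField E M 2) (Z : MultiVectorField E M 2) (β : FormField E M 2) :
    FormField E M 2 :=
  fun x => diracExp (η x) (Z x) (β x)

/-- `Z` is the bivector field with `Z♯ = -(η|_G♯)⁻¹`. -/
def IsInducedBivector (η : FormField E M 2) (G : TangentDistribution E M)
    (Z : MultiVectorField E M 2) : Prop :=
  ∀ x, IsNegInverse (η x) (G x) (Z x)

end Manifold

end PreSymplectic

end

open PreSymplectic

/-!
Write `A = id + Z♯ β♯`.  For `β ∈ I_Z` the two-form `F β` is characterised by the inverse-free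
identity `F β (A u, w) = β (u, w)` (`F_apply_idAdd`), and everything is deduced from it.

*Linear algebra at one point.*  Let `K = ker η`.  Since `η (Z♯ ξ, w) = -ξ w` for `w ∈ G`, one finds
`exp_η β (A v, w) = η (v, w)` for `w ∈ G` and `exp_η β (A v, w) = β (v, w)` for `w ∈ K`.  Hence
`A⁻¹ (ker (exp_η β))` consists of the `v ∈ K` with `β (v, ·)|_K = 0`
(`idAdd_mem_ker_diracExp_iff`): it lies in `K`, and equals `K` exactly when `β` is horizontal.  So
`exp_η β` has the rank of `η` if and only if `β` is horizontal (`finrank_range_diracExp_iff`), and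
in that case its kernel is again complementary to `G`, because `A` is the identity modulo `G`
(`isCompl_ker_diracExp`).  The map `F_Z` is inverted by `F_{-Z}` (`F_neg_F`), and if
`ker η'` is complementary to `G`, then `η' - η ∈ I_{-Z}` (`sub_mem_IZ_neg`); this gives the
bijection.

*The Maurer–Cartan equation.*  Let `∂` be the derivative in the coordinates of the chart around the
point considered.  Differentiating `F β (A u, w) = β (u, w)` in the direction `c` gives
`(∂_c F β) (A u, A v) = (∂_c β) (u, v) + (∂_c Z) (β♯ u, β♯ v)` (`fderiv_apply_idAddL`).  With
`c = A w = w + Z♯ β♯ w`, the cyclic sum over `u, v, w` is `d (F β) (A u, A v, A w)` on the left, and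
on the right the terms of order `0`, `1` and `2` in `Z` are
* `dβ (u, v, w)`,
* the cyclic sum of `(∂_{Z♯ β♯ w} β) (u, v) + (∂_w Z) (β♯ u, β♯ v)`, which is `½ λ₂ (β, β)`
  (`lambda₂_self_apply`), and
* the cyclic sum of `(∂_{Z♯ β♯ w} Z) (β♯ u, β♯ v)`, which is `½ [Z, Z] (β♯ u, β♯ v, β♯ w)`
  (`half_schouten_self_apply`) and therefore `⅙ λ₃ (β, β, β)` (`sharpWedgeTri_self`).

So the Maurer–Cartan expression of `β` is the pull-back of `d (F β)` by the automorphism `A`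
(`maurerCartan_apply`), and it vanishes if and only if `exp_η β = η + F β` is closed.

Smoothness of `Z` is seen in a local frame of `G`, where `Z` is given by the inverse of the Gram
matrix of `η` (`IsInducedBivector.isSmooth`).
-/

noncomputable section

namespace PreSymplectic

/-! ### Wedge products in low degrees -/

section LinearAlgebra
variable {V : Type*} [AddCommGroup V] [Module ℝ V]

/-- The wedge product as a sum over all permutations instead of shuffles. -/
theorem wedge_apply {p q : ℕ} (α : V [⋀^Fin p]→ₗ[ℝ] ℝ) (β : V [⋀^Fin q]→ₗ[ℝ] ℝ)
    (v : Fin (p + q) → V) :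
    ((p.factorial * q.factorial : ℕ) : ℝ) * wedge α β v =
      ∑ σ : Equiv.Perm (Fin (p + q)), ((Equiv.Perm.sign σ : ℤ) : ℝ) *
        (α (fun i => v (σ (Fin.castAdd q i))) * β (fun j => v (σ (Fin.natAdd p j)))) := by
  have h := MultilinearMap.domCoprod_alternization_eq α β
  have h2 := congrArg (fun f => LinearMap.mul' ℝ ℝ (f (v ∘ finSumFinEquiv))) h
  simp only [Fintype.card_fin] at h2
  have h3 : LinearMap.mul' ℝ ℝ (((p.factorial * q.factorial) • α.domCoprod β)
      (v ∘ finSumFinEquiv)) = ((p.factorial * q.factorial : ℕ) : ℝ) * wedge α β v := by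
    rw [AlternatingMap.smul_apply, map_nsmul, nsmul_eq_mul]
    rfl
  rw [← h3, ← h2, MultilinearMap.alternatization_apply, map_sum]
  refine Fintype.sum_equiv (Equiv.permCongr finSumFinEquiv) _ _ fun σ => ?_
  have hs : Equiv.Perm.sign ((Equiv.permCongr finSumFinEquiv) σ) = Equiv.Perm.sign σ :=
    Equiv.Perm.sign_permCongr _ _
  rw [hs, Units.smul_def, map_zsmul, zsmul_eq_mul]
  congr 1
  simp [MultilinearMap.domCoprod, Equiv.permCongr_apply]

theorem alternating_sum_apply {ι : Type*} {k : ℕ} (s : Finset ι) (f : ι → V [⋀^Fin k]→ₗ[ℝ] ℝ)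
    (v : Fin k → V) : (∑ i ∈ s, f i) v = ∑ i ∈ s, f i v := by
  classical
  induction s using Finset.induction_on with
  | empty => simp
  | insert a s ha ih => simp [Finset.sum_insert ha, ih]

theorem apply_swap (α : V [⋀^Fin 2]→ₗ[ℝ] ℝ) (u v : V) : α ![v, u] = -α ![u, v] := by
  have := α.map_swap ![u, v] (i := 0) (j := 1) (by decide)
  rw [← this]; congr 1; ext i; fin_cases i <;> rfl

theorem sum_perm_succ {n : ℕ} (f : Equiv.Perm (Fin (n + 1)) → ℝ) :
    ∑ σ, f σ = ∑ i : Fin (n + 1), ∑ τ : Equiv.Perm (Fin n),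
      f (Equiv.Perm.decomposeFin.symm (i, τ)) := by
  rw [Finset.univ_perm_fin_succ, Finset.sum_map, ← Finset.univ_product_univ, Finset.sum_product]
  rfl

theorem sum_perm_two (f : Fin 2 → Fin 2 → ℝ) :
    ∑ σ : Equiv.Perm (Fin 2), ((Equiv.Perm.sign σ : ℤ) : ℝ) * f (σ 0) (σ 1) =
      f 0 1 - f 1 0 := by
  have h : (Finset.univ : Finset (Equiv.Perm (Fin 2))) = {1, Equiv.swap 0 1} := by decide
  rw [h, Finset.sum_insert (by decide), Finset.sum_singleton]
  simp
  ring

theorem sum_perm_three (f : Fin 3 → Fin 3 → Fin 3 → ℝ) :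
    ∑ σ : Equiv.Perm (Fin 3), ((Equiv.Perm.sign σ : ℤ) : ℝ) * f (σ 0) (σ 1) (σ 2) =
      f 0 1 2 - f 0 2 1 - f 1 0 2 + f 1 2 0 + f 2 0 1 - f 2 1 0 := by
  have h : (Finset.univ : Finset (Equiv.Perm (Fin 3))) =
    {1, Equiv.swap 1 2, Equiv.swap 0 1, Equiv.swap 0 1 * Equiv.swap 1 2,
      Equiv.swap 1 2 * Equiv.swap 0 1, Equiv.swap 0 2} := by decide
  have e01 : Equiv.swap (0 : Fin 3) 1 2 = 2 := by decide
  have e12 : Equiv.swap (1 : Fin 3) 2 0 = 0 := by decide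
  have e02 : Equiv.swap (0 : Fin 3) 2 1 = 1 := by decide
  rw [h, Finset.sum_insert (by decide), Finset.sum_insert (by decide),
    Finset.sum_insert (by decide), Finset.sum_insert (by decide), Finset.sum_insert (by decide),
    Finset.sum_singleton]
  simp [Equiv.Perm.sign_mul, Equiv.Perm.sign_swap', e01, e12, e02]
  ring

theorem sum_perm_four (f : Fin 4 → Fin 4 → Fin 4 → Fin 4 → ℝ) :
    ∑ σ : Equiv.Perm (Fin 4), ((Equiv.Perm.sign σ : ℤ) : ℝ) * f (σ 0) (σ 1) (σ 2) (σ 3) =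
      f 0 1 2 3 - f 0 1 3 2 - f 0 2 1 3 + f 0 2 3 1 + f 0 3 1 2 - f 0 3 2 1
      - (f 1 0 2 3 - f 1 0 3 2 - f 1 2 0 3 + f 1 2 3 0 + f 1 3 0 2 - f 1 3 2 0)
      - (f 2 1 0 3 - f 2 1 3 0 - f 2 0 1 3 + f 2 0 3 1 + f 2 3 1 0 - f 2 3 0 1)
      - (f 3 1 2 0 - f 3 1 0 2 - f 3 2 1 0 + f 3 2 0 1 + f 3 0 1 2 - f 3 0 2 1) := by
  -- permutations of four letters, sorted by the image `i` of `0`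
  have key : ∀ i : Fin 4, ∑ τ : Equiv.Perm (Fin 3),
      ((Equiv.Perm.sign (Equiv.Perm.decomposeFin.symm (i, τ)) : ℤ) : ℝ) *
        f (Equiv.Perm.decomposeFin.symm (i, τ) 0) (Equiv.Perm.decomposeFin.symm (i, τ) 1)
          (Equiv.Perm.decomposeFin.symm (i, τ) 2) (Equiv.Perm.decomposeFin.symm (i, τ) 3) =
      (if i = 0 then 1 else -1) * ∑ τ : Equiv.Perm (Fin 3), ((Equiv.Perm.sign τ : ℤ) : ℝ) *
        (fun a b c => f i (Equiv.swap 0 i a.succ) (Equiv.swap 0 i b.succ)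
          (Equiv.swap 0 i c.succ)) (τ 0) (τ 1) (τ 2) := by
    intro i
    rw [Finset.mul_sum]
    refine Finset.sum_congr rfl fun τ _ => ?_
    have h0 := Equiv.Perm.decomposeFin_symm_apply_zero i τ
    have h1 := Equiv.Perm.decomposeFin_symm_apply_succ τ i 0
    have h2 := Equiv.Perm.decomposeFin_symm_apply_succ τ i 1
    have h3 := Equiv.Perm.decomposeFin_symm_apply_succ τ i 2
    simp only [Fin.succ_zero_eq_one, Fin.succ_one_eq_two] at h1 h2
    rw [show (Fin.succ 2 : Fin 4) = 3 from rfl] at h3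
    rw [h0, h1, h2, h3, Equiv.Perm.decomposeFin.symm_sign]
    split_ifs <;> simp
  have t : ∀ i : Fin 4, ∀ a : Fin 3, Equiv.swap (0 : Fin 4) i a.succ =
      (![![1, 2, 3], ![0, 2, 3], ![1, 0, 3], ![1, 2, 0]] : Fin 4 → Fin 3 → Fin 4) i a := by
    decide
  refine (sum_perm_succ (n := 3) _).trans ((Finset.sum_congr rfl fun i _ =>
    (key i).trans (congrArg _ (sum_perm_three (fun a b c => f i (Equiv.swap 0 i a.succ)
      (Equiv.swap 0 i b.succ) (Equiv.swap 0 i c.succ))))).trans ?_)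
  refine (Fin.sum_univ_four _).trans ?_
  simp only [t]
  simp
  ring

theorem wedge_one_one (α β : V [⋀^Fin 1]→ₗ[ℝ] ℝ) (v : Fin 2 → V) :
    wedge α β v = α ![v 0] * β ![v 1] - α ![v 1] * β ![v 0] := by
  have h := wedge_apply α β v
  have e : ∀ a : V, (fun _ : Fin 1 => a) = ![a] := fun a => by ext i; fin_cases i; rfl
  have h2 := sum_perm_two (fun i j => α ![v i] * β ![v j])
  have ea : ∀ σ : Equiv.Perm (Fin 2), (fun i : Fin 1 => v (σ (Fin.castAdd 1 i))) = ![v (σ 0)] :=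
    fun σ => by ext i; fin_cases i; rfl
  have eb : ∀ σ : Equiv.Perm (Fin 2), (fun i : Fin 1 => v (σ (Fin.natAdd 1 i))) = ![v (σ 1)] :=
    fun σ => by ext i; fin_cases i; rfl
  simp only [ea, eb] at h
  rw [h2] at h
  simpa using h

theorem wedge_two_one (α : V [⋀^Fin 2]→ₗ[ℝ] ℝ) (β : V [⋀^Fin 1]→ₗ[ℝ] ℝ) (v : Fin 3 → V) :
    wedge α β v = α ![v 0, v 1] * β ![v 2] + α ![v 1, v 2] * β ![v 0] +
      α ![v 2, v 0] * β ![v 1] := by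
  have h := wedge_apply α β v
  have h2 := sum_perm_three (fun i j k => α ![v i, v j] * β ![v k])
  have ea : ∀ σ : Equiv.Perm (Fin 3), (fun i : Fin 2 => v (σ (Fin.castAdd 1 i))) =
      ![v (σ 0), v (σ 1)] := fun σ => by ext i; fin_cases i <;> rfl
  have eb : ∀ σ : Equiv.Perm (Fin 3), (fun i : Fin 1 => v (σ (Fin.natAdd 2 i))) = ![v (σ 2)] :=
    fun σ => by ext i; fin_cases i; rfl
  simp only [ea, eb] at h
  rw [h2, apply_swap α (v 0) (v 1), apply_swap α (v 1) (v 2), apply_swap α (v 2) (v 0)] at h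
  norm_num [Nat.factorial] at h
  linarith

theorem wedge_one_two (α : V [⋀^Fin 1]→ₗ[ℝ] ℝ) (β : V [⋀^Fin 2]→ₗ[ℝ] ℝ) (v : Fin 3 → V) :
    wedge α β v = α ![v 0] * β ![v 1, v 2] + α ![v 1] * β ![v 2, v 0] +
      α ![v 2] * β ![v 0, v 1] := by
  have h := wedge_apply α β v
  have h2 := sum_perm_three (fun i j k => α ![v i] * β ![v j, v k])
  have ea : ∀ σ : Equiv.Perm (Fin 3), (fun i : Fin 1 => v (σ (Fin.castAdd 2 i))) =
      ![v (σ 0)] := fun σ => by ext i; fin_cases i; rfl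
  have eb : ∀ σ : Equiv.Perm (Fin 3), (fun i : Fin 2 => v (σ (Fin.natAdd 1 i))) =
      ![v (σ 1), v (σ 2)] := fun σ => by ext i; fin_cases i <;> rfl
  simp only [ea, eb] at h
  rw [h2, apply_swap β (v 0) (v 1), apply_swap β (v 1) (v 2), apply_swap β (v 2) (v 0)] at h
  norm_num [Nat.factorial] at h
  linarith

theorem wedge_two_two_self (β : V [⋀^Fin 2]→ₗ[ℝ] ℝ) (v : Fin 4 → V) :
    wedge β β v = 2 * (β ![v 0, v 1] * β ![v 2, v 3] - β ![v 0, v 2] * β ![v 1, v 3] +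
      β ![v 0, v 3] * β ![v 1, v 2]) := by
  have h := wedge_apply β β v
  have h2 := sum_perm_four (fun i j k l => β ![v i, v j] * β ![v k, v l])
  have ea : ∀ σ : Equiv.Perm (Fin 4), (fun i : Fin 2 => v (σ (Fin.castAdd 2 i))) =
      ![v (σ 0), v (σ 1)] := fun σ => by ext i; fin_cases i <;> rfl
  have eb : ∀ σ : Equiv.Perm (Fin 4), (fun i : Fin 2 => v (σ (Fin.natAdd 2 i))) =
      ![v (σ 2), v (σ 3)] := fun σ => by ext i; fin_cases i <;> rfl
  simp only [ea, eb] at h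
  rw [h2, apply_swap β (v 0) (v 1), apply_swap β (v 1) (v 2), apply_swap β (v 0) (v 2),
    apply_swap β (v 0) (v 3), apply_swap β (v 1) (v 3), apply_swap β (v 2) (v 3)] at h
  norm_num [Nat.factorial] at h
  linarith

end LinearAlgebra

/-! ### Contractions with bivectors and trivectors -/

section LinearAlgebra
variable {V : Type*} [AddCommGroup V] [Module ℝ V] [FiniteDimensional ℝ V]

theorem sum_dual_smul_coord (φ : Module.Dual ℝ V) :
    ∑ i, φ (Module.finBasis ℝ V i) • (Module.finBasis ℝ V).coord i = φ := by
  refine (Module.finBasis ℝ V).ext fun j => ?_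
  simp

theorem sum_bivector_mul (Z : MultiVector 2 V) (φ ψ : Module.Dual ℝ V) :
    ∑ i, ∑ j, Z ![(Module.finBasis ℝ V).coord i, (Module.finBasis ℝ V).coord j] *
      (φ (Module.finBasis ℝ V i) * ψ (Module.finBasis ℝ V j)) = Z ![φ, ψ] := by
  conv_rhs => rw [← flat_apply, ← sum_dual_smul_coord φ, ← sum_dual_smul_coord ψ]
  simp only [map_sum, map_smul, LinearMap.sum_apply, LinearMap.smul_apply, flat_apply,
    Finset.mul_sum, smul_eq_mul]
  rw [Finset.sum_comm]
  exact Finset.sum_congr rfl fun i _ => Finset.sum_congr rfl fun j _ => by ring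

theorem sum_trivector_mul (T : MultiVector 3 V) (φ ψ χ : Module.Dual ℝ V) :
    ∑ i, ∑ j, ∑ k, T ![(Module.finBasis ℝ V).coord i, (Module.finBasis ℝ V).coord j,
        (Module.finBasis ℝ V).coord k] * (φ (Module.finBasis ℝ V i) *
        ψ (Module.finBasis ℝ V j) * χ (Module.finBasis ℝ V k)) = T ![φ, ψ, χ] := by
  have h : ∀ i, ∑ j, ∑ k, T ![(Module.finBasis ℝ V).coord i, (Module.finBasis ℝ V).coord j,
        (Module.finBasis ℝ V).coord k] * (φ (Module.finBasis ℝ V i) *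
        ψ (Module.finBasis ℝ V j) * χ (Module.finBasis ℝ V k)) =
      φ (Module.finBasis ℝ V i) * T.curryLeft ((Module.finBasis ℝ V).coord i) ![ψ, χ] := by
    intro i
    rw [← sum_bivector_mul, Finset.mul_sum]
    refine Finset.sum_congr rfl fun j _ => ?_
    rw [Finset.mul_sum]
    refine Finset.sum_congr rfl fun k _ => ?_
    rw [AlternatingMap.curryLeft_apply_apply]
    ring
  rw [Finset.sum_congr rfl fun i _ => h i, ← AlternatingMap.curryLeft_apply_apply]
  conv_rhs => rw [← sum_dual_smul_coord φ]
  rw [map_sum, alternating_sum_apply]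
  simp

theorem sum_bivector_apply (Z : MultiVector 2 V) (β : V [⋀^Fin 2]→ₗ[ℝ] ℝ) (φ : Module.Dual ℝ V)
    (u : V) :
    ∑ i, ∑ j, Z ![(Module.finBasis ℝ V).coord i, (Module.finBasis ℝ V).coord j] *
      (φ (Module.finBasis ℝ V i) * β ![Module.finBasis ℝ V j, u]) =
      φ (sharp Z (flat β u)) := by
  have h := sum_bivector_mul Z φ (flat β u)
  rw [apply_sharp, apply_swap, ← h, ← Finset.sum_neg_distrib]
  refine Finset.sum_congr rfl fun i _ => ?_
  rw [← Finset.sum_neg_distrib]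
  refine Finset.sum_congr rfl fun j _ => ?_
  rw [flat_apply, apply_swap β u]
  ring

/-- The components `Z (eⁱ, eʲ)` are antisymmetric in `i, j`. -/
theorem sum_bivector_swap (Z : MultiVector 2 V)
    (f : Fin (Module.finrank ℝ V) → Fin (Module.finrank ℝ V) → ℝ) :
    ∑ i, ∑ j, Z ![(Module.finBasis ℝ V).coord i, (Module.finBasis ℝ V).coord j] * f j i =
      -∑ i, ∑ j, Z ![(Module.finBasis ℝ V).coord i, (Module.finBasis ℝ V).coord j] * f i j := by
  rw [Finset.sum_comm, ← Finset.sum_neg_distrib]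
  refine Finset.sum_congr rfl fun i _ => ?_
  rw [← Finset.sum_neg_distrib]
  refine Finset.sum_congr rfl fun j _ => ?_
  rw [apply_swap]
  ring

theorem contract_apply (Z : MultiVector 2 V) {k : ℕ} (α : V [⋀^Fin (k + 2)]→ₗ[ℝ] ℝ)
    (v : Fin k → V) :
    contract Z α v = (1 / 2) * ∑ i, ∑ j,
      Z ![(Module.finBasis ℝ V).coord i, (Module.finBasis ℝ V).coord j] *
        α (Matrix.vecCons (Module.finBasis ℝ V j) (Matrix.vecCons (Module.finBasis ℝ V i) v)) := by
  simp [contract, alternating_sum_apply]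

/-- `ι_Z (β ∧ β) = 2 (ι_Z β) β + 2 Z (β♯ ·, β♯ ·)`. -/
theorem contract_wedge_self (Z : MultiVector 2 V) (β : V [⋀^Fin 2]→ₗ[ℝ] ℝ) (v : Fin 2 → V) :
    contract Z (wedge β β) v = 2 * (contract Z β ![] * β v) +
      2 * Z ![flat β (v 0), flat β (v 1)] := by
  obtain ⟨u, w, rfl⟩ : ∃ u w, v = ![u, w] := ⟨v 0, v 1, by ext i; fin_cases i <;> rfl⟩
  have h1 := sum_bivector_mul Z (flat β u) (flat β w)
  have h2 := sum_bivector_swap Z (fun i j => flat β u (Module.finBasis ℝ V i) *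
    flat β w (Module.finBasis ℝ V j))
  rw [h1] at h2
  have e : ∀ a b : V, wedge β β (Matrix.vecCons a (Matrix.vecCons b ![u, w])) =
      2 * (β ![u, w] * β ![a, b]) - 2 * (flat β u a * flat β w b) +
        2 * (flat β u b * flat β w a) := by
    intro a b
    rw [wedge_two_two_self, flat_apply, flat_apply, flat_apply, flat_apply, apply_swap β a u,
      apply_swap β b w, apply_swap β a w, apply_swap β b u]
    simp
    ring
  rw [contract_apply, contract_apply]
  simp only [e, mul_add, mul_sub, Finset.sum_add_distrib, Finset.sum_sub_distrib]
  simp only [mul_left_comm _ (2 : ℝ), ← Finset.mul_sum]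
  simp only [mul_left_comm _ (β ![u, w]), ← Finset.mul_sum]
  simp only [Matrix.cons_val_zero, Matrix.cons_val_one]
  rw [h1, h2]
  ring

/-- For `α = 2 δ ∧ β` with `δ` of degree three and `β` of degree two, `ι_Z α` is
`2 ι_Z δ ∧ β + 2 (ι_Z β) δ` minus twice the cyclic sum of `δ (Z♯ β♯ u, v, w)`.  The hypothesis on
`α` is the shuffle expansion of `2 δ ∧ β`; it is applied to `δ = dβ`, `α = d (β ∧ β)`. -/
theorem contract_of_eq_two_wedge (Z : MultiVector 2 V) (β : V [⋀^Fin 2]→ₗ[ℝ] ℝ)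
    (δ : V [⋀^Fin 3]→ₗ[ℝ] ℝ) (α : V [⋀^Fin 5]→ₗ[ℝ] ℝ)
    (hα : ∀ a b u v w, α ![a, b, u, v, w] =
      2 * (δ ![a, b, u] * β ![v, w] - δ ![a, b, v] * β ![u, w] + δ ![a, b, w] * β ![u, v] +
        δ ![a, u, v] * β ![b, w] - δ ![a, u, w] * β ![b, v] + δ ![a, v, w] * β ![b, u] -
        δ ![b, u, v] * β ![a, w] + δ ![b, u, w] * β ![a, v] - δ ![b, v, w] * β ![a, u] +
        δ ![u, v, w] * β ![a, b])) (u v w : V) :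
    contract Z α ![u, v, w] =
      2 * (contract Z δ ![u] * β ![v, w] + contract Z δ ![v] * β ![w, u] +
        contract Z δ ![w] * β ![u, v]) + 2 * (contract Z β ![] * δ ![u, v, w]) -
      2 * (δ ![sharp Z (flat β u), v, w] + δ ![sharp Z (flat β v), w, u] +
        δ ![sharp Z (flat β w), u, v]) := by
  let φ : V → V → Module.Dual ℝ V := fun x y =>
    { toFun := fun a => δ ![a, x, y]
      map_add' := fun a b => δ.map_vecCons_add ![x, y] a b
      map_smul' := fun c a => δ.map_vecCons_smul ![x, y] c a }
  have hφ : ∀ x y a, δ ![a, x, y] = φ x y a := fun _ _ _ => rfl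
  have hδ : ∀ a x y, δ ![a, y, x] = -δ ![a, x, y] := fun a x y => apply_swap (δ.curryLeft a) x y
  have h1 := fun x y z => sum_bivector_apply Z β (φ x y) z
  have h2 := fun x y z => (sum_bivector_swap Z (fun i j => φ x y (Module.finBasis ℝ V i) *
    β ![Module.finBasis ℝ V j, z])).trans (congrArg _ (h1 x y z))
  have e : ∀ a b : V, α (Matrix.vecCons a (Matrix.vecCons b ![u, v, w])) =
      2 * (δ ![a, b, u] * β ![v, w]) - 2 * (δ ![a, b, v] * β ![u, w]) +
      2 * (δ ![a, b, w] * β ![u, v]) + 2 * (φ u v a * β ![b, w]) -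
      2 * (φ u w a * β ![b, v]) + 2 * (φ v w a * β ![b, u]) - 2 * (φ u v b * β ![a, w]) +
      2 * (φ u w b * β ![a, v]) - 2 * (φ v w b * β ![a, u]) + 2 * (β ![a, b] * δ ![u, v, w]) := by
    intro a b
    rw [hα]
    simp only [hφ]
    ring
  simp only [contract_apply]
  simp only [e, mul_add, mul_sub, Finset.sum_add_distrib, Finset.sum_sub_distrib]
  simp only [mul_left_comm _ (2 : ℝ), ← Finset.mul_sum, h1, h2]
  simp only [← mul_assoc _ (δ _) (β _), ← mul_assoc _ (β _) (δ _), ← Finset.sum_mul]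
  rw [hδ _ u w, apply_swap β u w]
  simp only [hφ]
  ring

/-- `(β♯ ∧ β♯ ∧ β♯)(T) = -6 T (β♯ ·, β♯ ·, β♯ ·)`.  The sign comes from
`(ι_a β)(u) = -(β♯ u)(a)`, three times. -/
theorem sharpWedgeTri_self (β : V [⋀^Fin 2]→ₗ[ℝ] ℝ) (T : MultiVector 3 V) (u v w : V) :
    (sharpWedgeTri β β β T : V [⋀^Fin 3]→ₗ[ℝ] ℝ) ![u, v, w] =
      -6 * T ![flat β u, flat β v, flat β w] := by
  have hi : ∀ a x : V, (interior a β : V [⋀^Fin 1]→ₗ[ℝ] ℝ) ![x] = -flat β x a := fun a x => by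
    rw [flat_apply, apply_swap β a x, neg_neg]; rfl
  have hw : ∀ a b c : V, wedge (wedge (interior a β : V [⋀^Fin 1]→ₗ[ℝ] ℝ)
      (interior b β : V [⋀^Fin 1]→ₗ[ℝ] ℝ)) (interior c β : V [⋀^Fin 1]→ₗ[ℝ] ℝ) ![u, v, w] =
      -((flat β u a * flat β v b - flat β v a * flat β u b) * flat β w c +
        (flat β v a * flat β w b - flat β w a * flat β v b) * flat β u c +
        (flat β w a * flat β u b - flat β u a * flat β w b) * flat β v c) := by
    intro a b c
    rw [wedge_two_one (wedge (interior a β : V [⋀^Fin 1]→ₗ[ℝ] ℝ)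
      (interior b β : V [⋀^Fin 1]→ₗ[ℝ] ℝ)), wedge_one_one, wedge_one_one, wedge_one_one]
    simp only [Matrix.cons_val_zero, Matrix.cons_val_one, Matrix.cons_val, hi]
    ring
  have hs : ∀ a b c : V, (sharpWedge β β β ![a, b, c] : V [⋀^Fin 3]→ₗ[ℝ] ℝ) ![u, v, w] =
      -6 * ((flat β u a * flat β v b - flat β v a * flat β u b) * flat β w c +
        (flat β v a * flat β w b - flat β w a * flat β v b) * flat β u c +
        (flat β w a * flat β u b - flat β u a * flat β w b) * flat β v c) := by
    intro a b c
    have h3 := sum_perm_three (fun i j k => wedge (wedge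
      (interior (![a, b, c] i) β : V [⋀^Fin 1]→ₗ[ℝ] ℝ)
      (interior (![a, b, c] j) β : V [⋀^Fin 1]→ₗ[ℝ] ℝ))
      (interior (![a, b, c] k) β : V [⋀^Fin 1]→ₗ[ℝ] ℝ) ![u, v, w])
    simp only [hw] at h3
    have h4 : (sharpWedge β β β ![a, b, c] : V [⋀^Fin 3]→ₗ[ℝ] ℝ) ![u, v, w] =
        ∑ σ : Equiv.Perm (Fin 3), ((Equiv.Perm.sign σ : ℤ) : ℝ) * wedge (wedge
          (interior (![a, b, c] (σ 0)) β : V [⋀^Fin 1]→ₗ[ℝ] ℝ)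
          (interior (![a, b, c] (σ 1)) β : V [⋀^Fin 1]→ₗ[ℝ] ℝ))
          (interior (![a, b, c] (σ 2)) β : V [⋀^Fin 1]→ₗ[ℝ] ℝ) ![u, v, w] := by
      rw [sharpWedge, reindex, dif_pos (by norm_num), AlternatingMap.domDomCongr_apply,
        alternating_sum_apply]
      rfl
    rw [h4]
    simp only [hw]
    rw [h3]
    simp only [Matrix.cons_val_zero, Matrix.cons_val_one, Matrix.cons_val]
    ring
  have h5 : (sharpWedgeTri β β β T : V [⋀^Fin 3]→ₗ[ℝ] ℝ) ![u, v, w] = (1 / 6) * ∑ i, ∑ j, ∑ k,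
      T ![(Module.finBasis ℝ V).coord i, (Module.finBasis ℝ V).coord j,
        (Module.finBasis ℝ V).coord k] *
      (sharpWedge β β β ![Module.finBasis ℝ V i, Module.finBasis ℝ V j, Module.finBasis ℝ V k] :
        V [⋀^Fin 3]→ₗ[ℝ] ℝ) ![u, v, w] := by
    rw [sharpWedgeTri, AlternatingMap.smul_apply]
    simp only [alternating_sum_apply]
    rfl
  have ht : ∀ x y z : V, (∑ i, ∑ j, ∑ k, T ![(Module.finBasis ℝ V).coord i,
      (Module.finBasis ℝ V).coord j, (Module.finBasis ℝ V).coord k] *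
      (flat β x (Module.finBasis ℝ V i) * flat β y (Module.finBasis ℝ V j) *
        flat β z (Module.finBasis ℝ V k))) = T ![flat β x, flat β y, flat β z] :=
    fun x y z => sum_trivector_mul T _ _ _
  have s01 : ∀ x y z : Module.Dual ℝ V, T ![y, x, z] = -T ![x, y, z] := fun x y z => by
    rw [← T.map_swap ![x, y, z] (i := 0) (j := 1) (by decide)]
    congr 1; ext i; fin_cases i <;> rfl
  have s12 : ∀ x y z : Module.Dual ℝ V, T ![x, z, y] = -T ![x, y, z] := fun x y z =>
    apply_swap (T.curryLeft x) y z
  have h6 : ∀ a b c : V, (sharpWedge β β β ![a, b, c] : V [⋀^Fin 3]→ₗ[ℝ] ℝ) ![u, v, w] =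
      6 * (flat β v a * flat β u b * flat β w c) - 6 * (flat β u a * flat β v b * flat β w c) +
      6 * (flat β w a * flat β v b * flat β u c) - 6 * (flat β v a * flat β w b * flat β u c) +
      6 * (flat β u a * flat β w b * flat β v c) - 6 * (flat β w a * flat β u b * flat β v c) := by
    intro a b c
    rw [hs]
    ring
  rw [h5]
  simp only [h6, mul_add, mul_sub, Finset.sum_add_distrib, Finset.sum_sub_distrib]
  simp only [mul_left_comm _ (6 : ℝ), ← Finset.mul_sum, ht]
  rw [s01 (flat β u) (flat β v) (flat β w), s12 (flat β v) (flat β u) (flat β w),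
    s12 (flat β w) (flat β u) (flat β v), s12 (flat β u) (flat β v) (flat β w),
    s01 (flat β u) (flat β w) (flat β v), s12 (flat β u) (flat β v) (flat β w),
    s01 (flat β u) (flat β v) (flat β w)]
  ring

end LinearAlgebra

/-! ### The map `F` and the kernel of the Dirac exponential -/

section LinearAlgebra
variable {V : Type*} [AddCommGroup V] [Module ℝ V] [FiniteDimensional ℝ V]

theorem twoForm_ext {W : Type*} [AddCommGroup W] [Module ℝ W] {α β : W [⋀^Fin 2]→ₗ[ℝ] ℝ}
    (h : ∀ u v, α ![u, v] = β ![u, v]) : α = β := by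
  ext v
  have hv : v = ![v 0, v 1] := by ext i; fin_cases i <;> rfl
  rw [hv]
  exact h _ _

theorem idAdd_apply (Z : MultiVector 2 V) (β : V [⋀^Fin 2]→ₗ[ℝ] ℝ) (v : V) :
    idAdd Z β v = v + sharp Z (flat β v) := rfl

theorem idAdd_surjective {Z : MultiVector 2 V} {β : V [⋀^Fin 2]→ₗ[ℝ] ℝ} (h : β ∈ IZ Z) :
    Function.Surjective (idAdd Z β) :=
  ((Module.End.isUnit_iff _).1 h).2

/-- The identity that characterises `F β` without an inverse. -/
theorem F_apply_idAdd {Z : MultiVector 2 V} {β : V [⋀^Fin 2]→ₗ[ℝ] ℝ} (h : β ∈ IZ Z) (u w : V) :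
    F Z β ![idAdd Z β u, w] = β ![u, w] := by
  have h1 : Ring.inverse (idAdd Z β) (idAdd Z β u) = u := by
    rw [← Module.End.mul_apply, Ring.inverse_mul_cancel _ h]; rfl
  change flat β (Ring.inverse (idAdd Z β) (idAdd Z β u)) w = _
  rw [h1, flat_apply]

theorem F_unique {Z : MultiVector 2 V} {α β : V [⋀^Fin 2]→ₗ[ℝ] ℝ} (h : β ∈ IZ Z)
    (hα : ∀ u w, α ![idAdd Z β u, w] = β ![u, w]) : F Z β = α := by
  refine twoForm_ext fun v w => ?_
  obtain ⟨u, rfl⟩ := idAdd_surjective h v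
  rw [F_apply_idAdd h, hα]

theorem sharp_neg (Z : MultiVector 2 V) (ξ : Module.Dual ℝ V) : sharp (-Z) ξ = -sharp Z ξ := by
  refine (Module.evalEquiv ℝ V).injective (LinearMap.ext fun ζ => ?_)
  simp [apply_sharp]

/-- `id + (-Z)♯ (F β)♯` is the inverse of `id + Z♯ β♯`. -/
theorem idAdd_neg_F_idAdd {Z : MultiVector 2 V} {β : V [⋀^Fin 2]→ₗ[ℝ] ℝ} (h : β ∈ IZ Z) (u : V) :
    idAdd (-Z) (F Z β) (idAdd Z β u) = u := by
  have h1 : flat (F Z β) (idAdd Z β u) = flat β u :=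
    LinearMap.ext fun w => F_apply_idAdd h u w
  rw [idAdd_apply, h1, sharp_neg, idAdd_apply, add_neg_cancel_right]

theorem F_mem_IZ_neg {Z : MultiVector 2 V} {β : V [⋀^Fin 2]→ₗ[ℝ] ℝ} (h : β ∈ IZ Z) :
    F Z β ∈ IZ (-Z) := by
  refine (Module.End.isUnit_iff _).2 ?_
  have hs : Function.Surjective (idAdd (-Z) (F Z β)) := fun u => ⟨_, idAdd_neg_F_idAdd h u⟩
  exact ⟨LinearMap.injective_iff_surjective.2 hs, hs⟩

/-- `F_{-Z}` is a left inverse of `F_Z`. -/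
theorem F_neg_F {Z : MultiVector 2 V} {β : V [⋀^Fin 2]→ₗ[ℝ] ℝ} (h : β ∈ IZ Z) :
    F (-Z) (F Z β) = β := by
  refine F_unique (F_mem_IZ_neg h) fun u w => ?_
  obtain ⟨u, rfl⟩ := idAdd_surjective h u
  rw [idAdd_neg_F_idAdd h, F_apply_idAdd h]

section Splitting

variable {η : V [⋀^Fin 2]→ₗ[ℝ] ℝ} {G : Submodule ℝ V} {Z : MultiVector 2 V}

theorem mem_ker_flat_iff {W : Type*} [AddCommGroup W] [Module ℝ W] {η : W [⋀^Fin 2]→ₗ[ℝ] ℝ}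
    {v : W} : v ∈ LinearMap.ker (flat η) ↔ ∀ w, η ![v, w] = 0 := by
  rw [LinearMap.mem_ker, LinearMap.ext_iff]
  rfl

/-- If `V = ker η ⊕ G`, then a vector that is `η`-orthogonal to `G` lies in `ker η`. -/
theorem mem_ker_flat_of_compl {W : Type*} [AddCommGroup W] [Module ℝ W]
    {η : W [⋀^Fin 2]→ₗ[ℝ] ℝ} {G : Submodule ℝ W} (hG : IsCompl (LinearMap.ker (flat η)) G) {v : W}
    (hv : ∀ w ∈ G, η ![v, w] = 0) : v ∈ LinearMap.ker (flat η) := by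
  refine mem_ker_flat_iff.2 fun w => ?_
  obtain ⟨κ, hκ, g, hg, rfl⟩ := Submodule.mem_sup.1 (hG.sup_eq_top ▸ Submodule.mem_top : w ∈ _)
  rw [← flat_apply, map_add, flat_apply, flat_apply, hv g hg, apply_swap,
    mem_ker_flat_iff.1 hκ, neg_zero, add_zero]

theorem eq_zero_of_mem_compl {W : Type*} [AddCommGroup W] [Module ℝ W]
    {η : W [⋀^Fin 2]→ₗ[ℝ] ℝ} {G : Submodule ℝ W} (hG : IsCompl (LinearMap.ker (flat η)) G) {v : W}
    (hvG : v ∈ G) (hv : ∀ w ∈ G, η ![v, w] = 0) : v = 0 :=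
  Submodule.disjoint_def.1 hG.disjoint v (mem_ker_flat_of_compl hG hv) hvG

/-- The restriction `η|_G♯ : G → G*` of a two-form. -/
def restrictFlat {W : Type*} [AddCommGroup W] [Module ℝ W] (η : W [⋀^Fin 2]→ₗ[ℝ] ℝ)
    (G : Submodule ℝ W) : G →ₗ[ℝ] Module.Dual ℝ G :=
  G.subtype.dualMap ∘ₗ flat η ∘ₗ G.subtype

theorem restrictFlat_bijective (hG : IsCompl (LinearMap.ker (flat η)) G) :
    Function.Bijective (restrictFlat η G) := by
  have hi : Function.Injective (restrictFlat η G) := by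
    refine (injective_iff_map_eq_zero _).2 fun g hg => ?_
    refine Subtype.ext (eq_zero_of_mem_compl hG g.2 fun w hw => ?_)
    exact LinearMap.congr_fun hg ⟨w, hw⟩
  exact ⟨hi, (LinearMap.injective_iff_surjective_of_finrank_eq_finrank
    Subspace.dual_finrank_eq.symm).1 hi⟩

/-- Every covector agrees on `G` with `η (g, ·)` for some `g ∈ G`, so that the condition
`IsNegInverse` determines `Z♯` on all covectors. -/
theorem exists_mem_compl_eq (hG : IsCompl (LinearMap.ker (flat η)) G) (ξ : Module.Dual ℝ V) :
    ∃ g ∈ G, ∀ w ∈ G, ξ w = η ![g, w] := by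
  obtain ⟨g, hg⟩ := (restrictFlat_bijective hG).2 (G.subtype.dualMap ξ)
  exact ⟨g, g.2, fun w hw => (LinearMap.congr_fun hg ⟨w, hw⟩).symm⟩

theorem exists_isNegInverse (hG : IsCompl (LinearMap.ker (flat η)) G) :
    ∃ Z : MultiVector 2 V, IsNegInverse η G Z := by
  let e := LinearEquiv.ofBijective _ (restrictFlat_bijective hG)
  let s : Module.Dual ℝ V →ₗ[ℝ] V := -(G.subtype ∘ₗ e.symm.toLinearMap ∘ₗ G.subtype.dualMap)
  have hs : ∀ ξ : Module.Dual ℝ V, ∀ w ∈ G, η ![s ξ, w] = -ξ w := by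
    intro ξ w hw
    have h := LinearMap.congr_fun (e.apply_symm_apply (G.subtype.dualMap ξ)) ⟨w, hw⟩
    have h' : η ![(e.symm (G.subtype.dualMap ξ) : V), w] = ξ w := h
    have h2 : s ξ = -(e.symm (G.subtype.dualMap ξ) : V) := rfl
    rw [h2, ← flat_apply, map_neg, LinearMap.neg_apply, flat_apply, h']
  have hsG : ∀ ξ, s ξ ∈ G := fun ξ => G.neg_mem (e.symm (G.subtype.dualMap ξ)).2
  have hB : (Module.Dual.eval ℝ V ∘ₗ s).IsAlt := by
    intro ξ
    have h := hs ξ (s ξ) (hsG ξ)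
    rw [η.map_eq_zero_of_eq ![s ξ, s ξ] (i := 0) (j := 1) rfl (by decide)] at h
    simpa using h.symm
  refine ⟨ofIsAlt _ hB, fun ξ g hg h => ?_⟩
  have h1 : sharp (ofIsAlt _ hB) ξ = s ξ := by
    refine (Module.evalEquiv ℝ V).injective (LinearMap.ext fun ζ => ?_)
    exact apply_sharp _ _ _
  rw [h1]
  refine eq_neg_of_add_eq_zero_left (eq_zero_of_mem_compl hG (G.add_mem (hsG ξ) hg) fun w hw => ?_)
  rw [← flat_apply, map_add, LinearMap.add_apply, flat_apply, flat_apply, hs ξ w hw, h w hw,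
    neg_add_cancel]

theorem IsNegInverse.unique (hG : IsCompl (LinearMap.ker (flat η)) G) {Z Z' : MultiVector 2 V}
    (hZ : IsNegInverse η G Z) (hZ' : IsNegInverse η G Z') : Z = Z' := by
  refine twoForm_ext fun ξ ζ => ?_
  obtain ⟨g, hg, h⟩ := exists_mem_compl_eq hG ξ
  rw [← apply_sharp, ← apply_sharp, hZ ξ g hg h, hZ' ξ g hg h]

theorem IsNegInverse.sharp_mem (hG : IsCompl (LinearMap.ker (flat η)) G)
    (hZ : IsNegInverse η G Z) (ξ : Module.Dual ℝ V) : sharp Z ξ ∈ G := by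
  obtain ⟨g, hg, h⟩ := exists_mem_compl_eq hG ξ
  rw [hZ ξ g hg h]
  exact G.neg_mem hg

theorem IsNegInverse.apply_sharp_left (hG : IsCompl (LinearMap.ker (flat η)) G)
    (hZ : IsNegInverse η G Z) (ξ : Module.Dual ℝ V) {w : V} (hw : w ∈ G) :
    η ![sharp Z ξ, w] = -ξ w := by
  obtain ⟨g, hg, h⟩ := exists_mem_compl_eq hG ξ
  rw [hZ ξ g hg h, ← flat_apply, map_neg, LinearMap.neg_apply, flat_apply, h w hw]

theorem diracExp_apply (η : V [⋀^Fin 2]→ₗ[ℝ] ℝ) {β : V [⋀^Fin 2]→ₗ[ℝ] ℝ} (hβ : β ∈ IZ Z)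
    (v w : V) : diracExp η Z β ![idAdd Z β v, w] =
      η ![v, w] + η ![sharp Z (flat β v), w] + β ![v, w] := by
  rw [diracExp, AlternatingMap.add_apply, F_apply_idAdd hβ, idAdd_apply, ← flat_apply η, map_add,
    LinearMap.add_apply, flat_apply, flat_apply]

/-- The kernel of `exp_η β`, transported by `id + Z♯ β♯`, is the kernel of the restriction of
`β` to `ker η`. -/
theorem idAdd_mem_ker_diracExp_iff (hG : IsCompl (LinearMap.ker (flat η)) G)
    (hZ : IsNegInverse η G Z) {β : V [⋀^Fin 2]→ₗ[ℝ] ℝ} (hβ : β ∈ IZ Z) (v : V) :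
    idAdd Z β v ∈ LinearMap.ker (flat (diracExp η Z β)) ↔
      v ∈ LinearMap.ker (flat η) ∧ ∀ κ ∈ LinearMap.ker (flat η), β ![v, κ] = 0 := by
  have hGw : ∀ w ∈ G, diracExp η Z β ![idAdd Z β v, w] = η ![v, w] := fun w hw => by
    rw [diracExp_apply η hβ, hZ.apply_sharp_left hG _ hw, flat_apply]
    ring
  have hKw : ∀ w ∈ LinearMap.ker (flat η), diracExp η Z β ![idAdd Z β v, w] = β ![v, w] := by
    intro w hw
    have h0 : ∀ u, η ![u, w] = 0 := fun u => by
      rw [apply_swap, mem_ker_flat_iff.1 hw, neg_zero]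
    rw [diracExp_apply η hβ, h0, h0, zero_add, zero_add]
  rw [mem_ker_flat_iff]
  constructor
  · intro h
    refine ⟨mem_ker_flat_of_compl hG fun w hw => ?_, fun κ hκ => ?_⟩
    · rw [← hGw w hw, h]
    · rw [← hKw κ hκ, h]
  · rintro ⟨hv, h⟩ w
    obtain ⟨κ, hκ, g, hg, rfl⟩ :=
      Submodule.mem_sup.1 (hG.sup_eq_top ▸ Submodule.mem_top : w ∈ LinearMap.ker (flat η) ⊔ G)
    rw [← flat_apply, map_add, flat_apply, flat_apply, hKw κ hκ, hGw g hg, h κ hκ,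
      mem_ker_flat_iff.1 hv, add_zero]

/-- The Dirac exponential preserves the rank exactly on horizontal forms: by
`idAdd_mem_ker_diracExp_iff` its kernel is isomorphic to a subspace of `ker η`. -/
theorem finrank_range_diracExp_iff (hG : IsCompl (LinearMap.ker (flat η)) G)
    (hZ : IsNegInverse η G Z) {β : V [⋀^Fin 2]→ₗ[ℝ] ℝ} (hβ : β ∈ IZ Z) :
    Module.finrank ℝ (LinearMap.range (flat (diracExp η Z β))) =
        Module.finrank ℝ (LinearMap.range (flat η)) ↔
      ∀ u ∈ LinearMap.ker (flat η), ∀ v ∈ LinearMap.ker (flat η), β ![u, v] = 0 := by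
  have h1 := LinearMap.finrank_range_add_finrank_ker (flat (diracExp η Z β))
  have h2 := LinearMap.finrank_range_add_finrank_ker (flat η)
  let e := LinearEquiv.ofBijective (idAdd Z β) ((Module.End.isUnit_iff _).1 hβ)
  set L := (LinearMap.ker (flat (diracExp η Z β))).comap e.toLinearMap with hL
  have h3 : Module.finrank ℝ L = Module.finrank ℝ (LinearMap.ker (flat (diracExp η Z β))) := by
    have := LinearEquiv.finrank_eq (e.submoduleMap L)
    rw [this, hL, Submodule.map_comap_eq_of_surjective e.surjective]
  have hmem : ∀ v, v ∈ L ↔ _ := idAdd_mem_ker_diracExp_iff hG hZ hβ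
  have hle : L ≤ LinearMap.ker (flat η) := fun v hv => ((hmem v).1 hv).1
  constructor
  · intro h u hu v hv
    -- equal ranks mean equal dimensions of the kernels
    have : L = LinearMap.ker (flat η) := Submodule.eq_of_le_of_finrank_eq hle (by omega)
    exact ((hmem u).1 (this ▸ hu)).2 v hv
  · intro h
    have : L = LinearMap.ker (flat η) :=
      le_antisymm hle fun v hv => (hmem v).2 ⟨hv, fun κ hκ => h v hv κ hκ⟩
    rw [this] at h3
    omega

theorem isCompl_ker_diracExp (hG : IsCompl (LinearMap.ker (flat η)) G)
    (hZ : IsNegInverse η G Z) {β : V [⋀^Fin 2]→ₗ[ℝ] ℝ} (hβ : β ∈ IZ Z)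
    (h : ∀ u ∈ LinearMap.ker (flat η), ∀ v ∈ LinearMap.ker (flat η), β ![u, v] = 0) :
    IsCompl (LinearMap.ker (flat (diracExp η Z β))) G := by
  refine ⟨Submodule.disjoint_def.2 fun x hx hxG => ?_, codisjoint_iff.2 (eq_top_iff.2 ?_)⟩
  · obtain ⟨v, rfl⟩ := idAdd_surjective hβ x
    have hv := ((idAdd_mem_ker_diracExp_iff hG hZ hβ v).1 hx).1
    have hvG : v ∈ G := by
      have := G.sub_mem hxG (hZ.sharp_mem hG (flat β v))
      rwa [idAdd_apply, add_sub_cancel_right] at this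
    rw [Submodule.disjoint_def.1 hG.disjoint v hv hvG, map_zero]
  · intro x _
    obtain ⟨v, rfl⟩ := idAdd_surjective hβ x
    obtain ⟨κ, hκ, g, hg, rfl⟩ :=
      Submodule.mem_sup.1 (hG.sup_eq_top ▸ Submodule.mem_top : v ∈ LinearMap.ker (flat η) ⊔ G)
    rw [map_add]
    refine Submodule.add_mem_sup
      ((idAdd_mem_ker_diracExp_iff hG hZ hβ κ).2 ⟨hκ, fun κ' hκ' => h κ hκ κ' hκ'⟩) ?_
    rw [idAdd_apply]
    exact G.add_mem hg (hZ.sharp_mem hG _)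

/-- A vector `v` killed by `id - Z♯ (η' - η)♯` equals `Z♯ (η' - η)♯ v`, so it lies in `G` and
`η (v, w) = -(η' - η) (v, w)` for `w ∈ G`; hence `η' (v, ·)` vanishes on `G` and `v = 0`. -/
theorem sub_mem_IZ_neg (hG : IsCompl (LinearMap.ker (flat η)) G) (hZ : IsNegInverse η G Z)
    {η' : V [⋀^Fin 2]→ₗ[ℝ] ℝ} (hG' : IsCompl (LinearMap.ker (flat η')) G) :
    η' - η ∈ IZ (-Z) := by
  have hi : Function.Injective (idAdd (-Z) (η' - η)) := by
    refine (injective_iff_map_eq_zero _).2 fun v hv => ?_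
    rw [idAdd_apply, sharp_neg] at hv
    have hv' : v = sharp Z (flat (η' - η) v) := by rwa [← sub_eq_add_neg, sub_eq_zero] at hv
    have hvG : v ∈ G := hv' ▸ hZ.sharp_mem hG _
    refine eq_zero_of_mem_compl hG' hvG fun w hw => ?_
    have h := hZ.apply_sharp_left hG (flat (η' - η) v) hw
    rw [← hv', flat_apply, AlternatingMap.sub_apply] at h
    linarith
  exact (Module.End.isUnit_iff _).2 ⟨hi, LinearMap.injective_iff_surjective.1 hi⟩

end Splitting
end LinearAlgebra

/-! ### Two-forms and bivectors in charts; smoothness of `F β` -/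

section Normed
variable {W : Type*} [NormedAddCommGroup W] [NormedSpace ℝ W]

/-- Smoothness of a family of alternating maps on a finite-dimensional space can be tested on each
argument. -/
theorem contDiffOn_alternating [FiniteDimensional ℝ W] {X : Type*} [NormedAddCommGroup X]
    [NormedSpace ℝ X] {k : ℕ} {n : WithTop ℕ∞} {f : X → W [⋀^Fin k]→L[ℝ] ℝ} {s : Set X}
    (h : ∀ v, ContDiffOn ℝ n (fun x => f x v) s) : ContDiffOn ℝ n f s := by
  let b := Module.finBasis ℝ W
  let L : (W [⋀^Fin k]→L[ℝ] ℝ) →ₗ[ℝ] ((Fin k → Fin (Module.finrank ℝ W)) → ℝ) :=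
    { toFun := fun g r => g fun i => b (r i)
      map_add' := fun _ _ => rfl
      map_smul' := fun _ _ => rfl }
  have hL : LinearMap.ker L = ⊥ := by
    refine LinearMap.ker_eq_bot'.2 fun g hg => ?_
    have h0 : g.toAlternatingMap = 0 :=
      b.ext_alternating fun r _ => congrFun hg r
    ext v
    exact DFunLike.congr_fun h0 v
  obtain ⟨P, hP⟩ := L.exists_leftInverse_of_injective hL
  have hf : f = fun x => LinearMap.toContinuousLinearMap P (L (f x)) := by
    funext x
    exact (LinearMap.congr_fun hP (f x)).symm
  rw [hf]
  exact (ContinuousLinearMap.contDiff _).comp_contDiffOn (contDiffOn_pi.2 fun r => h _)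

/-- The continuous bilinear map of a continuous alternating two-form, depending linearly on it. -/
def curryTwo (W : Type*) [NormedAddCommGroup W] [NormedSpace ℝ W] :
    (W [⋀^Fin 2]→L[ℝ] ℝ) →L[ℝ] W →L[ℝ] W →L[ℝ] ℝ :=
  (ContinuousLinearMap.compL ℝ W (W [⋀^Fin 1]→L[ℝ] ℝ) (W →L[ℝ] ℝ)
    (ContinuousAlternatingMap.ofSubsingletonLIE (𝕜 := ℝ) (E := W) (F := ℝ)
      (0 : Fin 1)).symm.toContinuousLinearEquiv.toContinuousLinearMap).comp
    (ContinuousAlternatingMap.curryLeftLI (𝕜 := ℝ) (E := W) (F := ℝ) (n := 1)).toContinuousLinearMap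

@[simp] theorem curryTwo_apply (b : W [⋀^Fin 2]→L[ℝ] ℝ) (u v : W) :
    curryTwo W b u v = b ![u, v] := by
  have h : curryTwo W b u v = b (Matrix.vecCons u fun _ : Fin 1 => v) := rfl
  rw [h]
  congr 2
  ext i
  fin_cases i
  rfl

theorem contDiff_curryTwo {n : WithTop ℕ∞} : ContDiff ℝ n (curryTwo W) := by fun_prop

variable [FiniteDimensional ℝ W]

/-- The identification of a finite-dimensional space with its continuous bidual. -/
def ofBidual (W : Type*) [NormedAddCommGroup W] [NormedSpace ℝ W] [FiniteDimensional ℝ W] :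
    ((W →L[ℝ] ℝ) →L[ℝ] ℝ) →L[ℝ] W :=
  LinearMap.toContinuousLinearMap ((Module.evalEquiv ℝ W).symm.toLinearMap ∘ₗ
    (LinearMap.toContinuousLinearMap (𝕜 := ℝ) (E := W) (F' := ℝ)).toLinearMap.dualMap ∘ₗ
      ContinuousLinearMap.coeLM ℝ)

theorem apply_ofBidual (Φ : (W →L[ℝ] ℝ) →L[ℝ] ℝ) (ζ : W →L[ℝ] ℝ) : ζ (ofBidual W Φ) = Φ ζ := by
  have h : Module.evalEquiv ℝ W (ofBidual W Φ) =
      (LinearMap.toContinuousLinearMap (𝕜 := ℝ) (E := W) (F' := ℝ)).toLinearMap.dualMap Φ := by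
    simp [ofBidual]
  exact LinearMap.congr_fun h ζ.toLinearMap

/-- The continuous linear map `ξ ↦ z (ξ, ·)` from covectors to vectors of a bivector `z`,
depending linearly on `z`. -/
def sharpL (W : Type*) [NormedAddCommGroup W] [NormedSpace ℝ W] [FiniteDimensional ℝ W] :
    ((W →L[ℝ] ℝ) [⋀^Fin 2]→L[ℝ] ℝ) →L[ℝ] (W →L[ℝ] ℝ) →L[ℝ] W :=
  (ContinuousLinearMap.compL ℝ (W →L[ℝ] ℝ) ((W →L[ℝ] ℝ) →L[ℝ] ℝ) W (ofBidual W)).comp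
    (curryTwo (W →L[ℝ] ℝ))

theorem contDiff_sharpL {n : WithTop ℕ∞} : ContDiff ℝ n (sharpL W) := by fun_prop

theorem apply_sharpL (z : (W →L[ℝ] ℝ) [⋀^Fin 2]→L[ℝ] ℝ) (ξ ζ : W →L[ℝ] ℝ) :
    ζ (sharpL W z ξ) = z ![ξ, ζ] := by
  rw [← curryTwo_apply, ← apply_ofBidual]
  rfl

/-- Continuous covectors separate the points of a finite-dimensional space. -/
theorem eq_of_forall_dual_eq {u v : W} (h : ∀ ζ : W →L[ℝ] ℝ, ζ u = ζ v) : u = v :=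
  (Module.evalEquiv ℝ W).injective
    (LinearMap.ext fun ζ => h (LinearMap.toContinuousLinearMap ζ))

/-- The endomorphism `id + z♯ b♯` in terms of continuous forms. -/
def idAddL (z : (W →L[ℝ] ℝ) [⋀^Fin 2]→L[ℝ] ℝ) (b : W [⋀^Fin 2]→L[ℝ] ℝ) : W →L[ℝ] W :=
  ContinuousLinearMap.id ℝ W + (sharpL W z).comp (curryTwo W b)

theorem idAddL_apply (z : (W →L[ℝ] ℝ) [⋀^Fin 2]→L[ℝ] ℝ) (b : W [⋀^Fin 2]→L[ℝ] ℝ) (u : W) :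
    idAddL z b u = u + sharpL W z (curryTwo W b u) := rfl

end Normed

section Manifold
variable {E : Type*} [NormedAddCommGroup E] [NormedSpace ℝ E]
  {M : Type*} [TopologicalSpace M] [ChartedSpace E M]

theorem chartDeriv_chartSymmDeriv [IsManifold 𝓘(ℝ, E) ∞ M] (x₀ : M) {y : E}
    (hy : y ∈ (chartAt E x₀).target) (u : E) :
    chartDeriv x₀ ((chartAt E x₀).symm y) (chartSymmDeriv x₀ y u) = u := by
  have : IsManifold 𝓘(ℝ, E) 1 M := IsManifold.of_le (n := ∞) (by norm_num)
  have h := DFunLike.congr_fun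
    ((mdifferentiable_chart (I := 𝓘(ℝ, E)) x₀).comp_symm_deriv hy) u
  exact h

theorem chartDeriv_bijective [IsManifold 𝓘(ℝ, E) ∞ M] (x₀ : M) {x : M}
    (hx : x ∈ (chartAt E x₀).source) :
    Function.Bijective (chartDeriv (E := E) x₀ x) := by
  have : IsManifold 𝓘(ℝ, E) 1 M := IsManifold.of_le (n := ∞) (by norm_num)
  exact ((mdifferentiable_chart (I := 𝓘(ℝ, E)) x₀).mfderiv hx).bijective

theorem chartSymmDeriv_chartDeriv [IsManifold 𝓘(ℝ, E) ∞ M] (x₀ : M) {y : E}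
    (hy : y ∈ (chartAt E x₀).target) (v : TangentSpace 𝓘(ℝ, E) ((chartAt E x₀).symm y)) :
    chartSymmDeriv x₀ y (chartDeriv x₀ ((chartAt E x₀).symm y) v) = v :=
  (chartDeriv_bijective x₀ ((chartAt E x₀).map_target hy)).1 (chartDeriv_chartSymmDeriv x₀ hy _)

variable [FiniteDimensional ℝ E]

theorem FormField.inChart_apply {k : ℕ} (α : FormField E M k) (x₀ : M) (y : E) (v : Fin k → E) :
    α.inChart x₀ y v = α ((chartAt E x₀).symm y) (fun i => chartSymmDeriv x₀ y (v i)) := rfl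

theorem FormField.inChart_apply_two (α : FormField E M 2) (x₀ : M) (y : E) (u v : E) :
    α.inChart x₀ y ![u, v] =
      α ((chartAt E x₀).symm y) ![chartSymmDeriv x₀ y u, chartSymmDeriv x₀ y v] := by
  rw [FormField.inChart_apply]
  congr 1
  ext i
  fin_cases i <;> rfl

theorem MultiVectorField.inChart_apply_two (P : MultiVectorField E M 2) (x₀ : M) (y : E)
    (ξ ζ : E →L[ℝ] ℝ) :
    P.inChart x₀ y ![ξ, ζ] = P ((chartAt E x₀).symm y)
      ![ξ.toLinearMap ∘ₗ (chartDeriv x₀ ((chartAt E x₀).symm y)).toLinearMap,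
        ζ.toLinearMap ∘ₗ (chartDeriv x₀ ((chartAt E x₀).symm y)).toLinearMap] := by
  have h : P.inChart x₀ y ![ξ, ζ] = P ((chartAt E x₀).symm y)
      (fun i => (![ξ, ζ] i).toLinearMap ∘ₗ
        (chartDeriv x₀ ((chartAt E x₀).symm y)).toLinearMap) := rfl
  rw [h]
  congr 1
  ext i
  fin_cases i <;> rfl

theorem sharpL_inChart (P : MultiVectorField E M 2) (x₀ : M) (y : E) (ξ : E →L[ℝ] ℝ) :
    sharpL E (P.inChart x₀ y) ξ = chartDeriv x₀ ((chartAt E x₀).symm y)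
      (sharp (P ((chartAt E x₀).symm y))
        (ξ.toLinearMap ∘ₗ (chartDeriv x₀ ((chartAt E x₀).symm y)).toLinearMap)) := by
  refine eq_of_forall_dual_eq fun ζ => ?_
  rw [apply_sharpL, MultiVectorField.inChart_apply_two, ← apply_sharp]
  rfl

theorem contDiffOn_idAddL_inChart {Z : MultiVectorField E M 2} {β : FormField E M 2}
    (hZ : Z.IsSmooth) (hβ : β.IsSmooth) (x₀ : M) :
    ContDiffOn ℝ ∞ (fun y => idAddL (Z.inChart x₀ y) (β.inChart x₀ y)) (chartAt E x₀).target := by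
  have hc : ContDiffOn ℝ ∞ (fun y => curryTwo E (β.inChart x₀ y)) (chartAt E x₀).target :=
    (contDiff_curryTwo (W := E)).comp_contDiffOn (hβ x₀)
  have hz : ContDiffOn ℝ ∞ (fun y => sharpL E (Z.inChart x₀ y)) (chartAt E x₀).target :=
    (contDiff_sharpL (W := E)).comp_contDiffOn (hZ x₀)
  exact contDiffOn_const.add (hz.clm_comp hc)

variable [IsManifold 𝓘(ℝ, E) ∞ M]

/-- The chart intertwines `id + Z♯ β♯` with its coordinate expression. -/
theorem idAddL_inChart (Z : MultiVectorField E M 2) (β : FormField E M 2) (x₀ : M) {y : E}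
    (hy : y ∈ (chartAt E x₀).target) (v : TangentSpace 𝓘(ℝ, E) ((chartAt E x₀).symm y)) :
    idAddL (Z.inChart x₀ y) (β.inChart x₀ y) (chartDeriv x₀ ((chartAt E x₀).symm y) v) =
      chartDeriv x₀ ((chartAt E x₀).symm y)
        (idAdd (Z ((chartAt E x₀).symm y)) (β ((chartAt E x₀).symm y)) v) := by
  rw [idAddL_apply, idAdd_apply, map_add, sharpL_inChart]
  congr 4
  ext w
  change curryTwo E (β.inChart x₀ y) _ (chartDeriv x₀ ((chartAt E x₀).symm y) w) = _
  rw [curryTwo_apply, FormField.inChart_apply_two, chartSymmDeriv_chartDeriv x₀ hy,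
    chartSymmDeriv_chartDeriv x₀ hy]
  rfl

/-- The field of two-forms `F (β)`. -/
def FField (Z : MultiVectorField E M 2) (β : FormField E M 2) : FormField E M 2 :=
  fun x => F (Z x) (β x)

theorem isUnit_idAddL_inChart {Z : MultiVectorField E M 2} {β : FormField E M 2}
    (hβ : ∀ x, β x ∈ IZ (Z x)) (x₀ : M) {y : E} (hy : y ∈ (chartAt E x₀).target) :
    IsUnit (idAddL (Z.inChart x₀ y) (β.inChart x₀ y)) := by
  have hs : Function.Surjective (idAddL (Z.inChart x₀ y) (β.inChart x₀ y)) := fun u => by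
    obtain ⟨v, hv⟩ := idAdd_surjective (hβ ((chartAt E x₀).symm y)) (chartSymmDeriv x₀ y u)
    exact ⟨_, by rw [idAddL_inChart Z β x₀ hy, hv, chartDeriv_chartSymmDeriv x₀ hy]⟩
  have hi : Function.Injective (idAddL (Z.inChart x₀ y) (β.inChart x₀ y)) :=
    (LinearMap.injective_iff_surjective
      (f := (idAddL (Z.inChart x₀ y) (β.inChart x₀ y)).toLinearMap)).2 hs
  let e := (LinearEquiv.ofBijective
    (idAddL (Z.inChart x₀ y) (β.inChart x₀ y)).toLinearMap ⟨hi, hs⟩).toContinuousLinearEquiv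
  refine ⟨ContinuousLinearEquiv.toUnit e, ?_⟩
  ext u
  rfl

theorem inChart_FField_apply {Z : MultiVectorField E M 2} {β : FormField E M 2}
    (hβ : ∀ x, β x ∈ IZ (Z x)) (x₀ : M) {y : E} (hy : y ∈ (chartAt E x₀).target) (u w : E) :
    (FField Z β).inChart x₀ y ![idAddL (Z.inChart x₀ y) (β.inChart x₀ y) u, w] =
      β.inChart x₀ y ![u, w] := by
  have hu : u = chartDeriv x₀ ((chartAt E x₀).symm y) (chartSymmDeriv x₀ y u) :=
    (chartDeriv_chartSymmDeriv x₀ hy u).symm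
  rw [FormField.inChart_apply_two, FormField.inChart_apply_two]
  conv_lhs => rw [hu, idAddL_inChart Z β x₀ hy, chartSymmDeriv_chartDeriv x₀ hy]
  exact F_apply_idAdd (hβ _) _ _

/-- In a chart `F β (u, w) = β (A⁻¹ u, w)` with `A = id + Z♯ β♯`, and inversion is smooth on
invertible endomorphisms. -/
theorem isSmooth_FField {Z : MultiVectorField E M 2} {β : FormField E M 2}
    (hZ : Z.IsSmooth) (hβs : β.IsSmooth) (hβ : ∀ x, β x ∈ IZ (Z x)) : (FField Z β).IsSmooth := by
  intro x₀
  have hc : ContDiffOn ℝ ∞ (fun y => curryTwo E (β.inChart x₀ y)) (chartAt E x₀).target :=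
    (contDiff_curryTwo (W := E)).comp_contDiffOn (hβs x₀)
  have hA := contDiffOn_idAddL_inChart hZ hβs x₀
  have hI : ContDiffOn ℝ ∞ (fun y => Ring.inverse (idAddL (Z.inChart x₀ y) (β.inChart x₀ y)))
      (chartAt E x₀).target := by
    intro y hy
    obtain ⟨a, ha⟩ := isUnit_idAddL_inChart hβ x₀ hy
    have h := contDiffAt_ringInverse ℝ (n := ∞) a
    rw [ha] at h
    exact h.comp_contDiffWithinAt y (hA y hy)
  refine contDiffOn_alternating fun v => ?_
  have hv : v = ![v 0, v 1] := by ext i; fin_cases i <;> rfl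
  have h2 : ContDiffOn ℝ ∞ (fun y => curryTwo E (β.inChart x₀ y)
      (Ring.inverse (idAddL (Z.inChart x₀ y) (β.inChart x₀ y)) (v 0)) (v 1))
      (chartAt E x₀).target :=
    (hc.clm_apply (hI.clm_apply contDiffOn_const)).clm_apply contDiffOn_const
  refine h2.congr fun y hy => ?_
  have h3 : v 0 = idAddL (Z.inChart x₀ y) (β.inChart x₀ y)
      (Ring.inverse (idAddL (Z.inChart x₀ y) (β.inChart x₀ y)) (v 0)) :=
    (DFunLike.congr_fun (Ring.mul_inverse_cancel _ (isUnit_idAddL_inChart hβ x₀ hy)) (v 0)).symm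
  rw [hv]
  conv_lhs => rw [h3, inChart_FField_apply hβ x₀ hy]
  rw [curryTwo_apply]
  rfl

end Manifold

/-! ### Smoothness of the induced bivector field -/

section Matrices

variable {X : Type*} [NormedAddCommGroup X] [NormedSpace ℝ X] {m : Type*} [Fintype m]
  [DecidableEq m]

theorem contDiffOn_det {n : WithTop ℕ∞} {N : X → Matrix m m ℝ} {s : Set X}
    (h : ∀ i j, ContDiffOn ℝ n (fun x => N x i j) s) : ContDiffOn ℝ n (fun x => (N x).det) s := by
  simp only [Matrix.det_apply, Units.smul_def, zsmul_eq_mul]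
  exact ContDiffOn.sum fun σ _ => contDiffOn_const.mul (contDiffOn_prod fun i _ => h _ _)

theorem contDiffOn_inv_apply {n : WithTop ℕ∞} {N : X → Matrix m m ℝ} {s : Set X}
    (h : ∀ i j, ContDiffOn ℝ n (fun x => N x i j) s) (hN : ∀ x ∈ s, IsUnit (N x)) (i j : m) :
    ContDiffOn ℝ n (fun x => (N x)⁻¹ i j) s := by
  have h0 : ∀ x ∈ s, (N x).det ≠ 0 := fun x hx =>
    ((Matrix.isUnit_iff_isUnit_det _).1 (hN x hx)).ne_zero
  have h1 : ContDiffOn ℝ n (fun x => (N x).adjugate i j) s := by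
    simp only [Matrix.adjugate_apply]
    refine contDiffOn_det fun a b => ?_
    by_cases hb : a = j
    · subst hb
      simp only [Matrix.updateRow_self]
      exact contDiffOn_const
    · simp only [Matrix.updateRow_ne hb]
      exact h a b
  refine (((contDiffOn_det h).inv h0).mul h1).congr fun x _ => ?_
  rw [Matrix.inv_def, Matrix.smul_apply, Ring.inverse_eq_inv', smul_eq_mul]
  rfl

end Matrices

section LinearAlgebra

variable {V : Type*} [AddCommGroup V] [Module ℝ V] {η : V [⋀^Fin 2]→ₗ[ℝ] ℝ} {G : Submodule ℝ V}

/-- The Gram matrix of a two-form in a family of vectors. -/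
def gram {r : ℕ} (η : V [⋀^Fin 2]→ₗ[ℝ] ℝ) (X : Fin r → V) : Matrix (Fin r) (Fin r) ℝ :=
  Matrix.of fun i j => η ![X i, X j]

theorem apply_sum_eq_vecMul_gram {r : ℕ} (X : Fin r → V) (c : Fin r → ℝ) (j : Fin r) :
    η ![∑ i, c i • X i, X j] = Matrix.vecMul c (gram η X) j := by
  rw [← flat_apply]
  simp [Matrix.vecMul, dotProduct, gram]

theorem forall_mem_span_range {r : ℕ} {X : Fin r → V}
    (hX : Submodule.span ℝ (Set.range X) = G) {φ ψ : Module.Dual ℝ V}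
    (h : ∀ j, φ (X j) = ψ (X j)) : ∀ w ∈ G, φ w = ψ w := by
  have h1 : Set.EqOn φ ψ (Set.range X) := by
    rintro _ ⟨j, rfl⟩
    exact h j
  intro w hw
  rw [← hX] at hw
  exact LinearMap.eqOn_span h1 hw

theorem isUnit_gram (hG : IsCompl (LinearMap.ker (flat η)) G) {r : ℕ} {X : Fin r → V}
    (hli : LinearIndependent ℝ X) (hX : Submodule.span ℝ (Set.range X) = G) :
    IsUnit (gram η X) := by
  rw [← Matrix.vecMul_injective_iff_isUnit]
  refine (injective_iff_map_eq_zero (Matrix.vecMulLinear (gram η X))).2 fun c hc => ?_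
  have hmem : ∑ i, c i • X i ∈ G := hX ▸ Submodule.sum_mem _ fun i _ =>
    Submodule.smul_mem _ _ (Submodule.subset_span ⟨i, rfl⟩)
  have h0 := eq_zero_of_mem_compl hG hmem fun w hw =>
    forall_mem_span_range hX (φ := flat η (∑ i, c i • X i)) (ψ := 0)
      (fun j => by
        rw [flat_apply, apply_sum_eq_vecMul_gram]
        exact congrFun hc j) w hw
  exact funext (Fintype.linearIndependent_iff.1 hli c h0)

variable [FiniteDimensional ℝ V] {Z : MultiVector 2 V}

/-- In a basis `X` of `G`, the bivector with `Z♯ = -(η|_G♯)⁻¹` is minus the inverse Gram matrix. -/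
theorem IsNegInverse.apply_eq_sum (hG : IsCompl (LinearMap.ker (flat η)) G)
    (hZ : IsNegInverse η G Z) {r : ℕ} {X : Fin r → V} (hli : LinearIndependent ℝ X)
    (hX : Submodule.span ℝ (Set.range X) = G) (ξ ζ : Module.Dual ℝ V) :
    Z ![ξ, ζ] = -∑ i, (∑ j, ξ (X j) * (gram η X)⁻¹ j i) * ζ (X i) := by
  set c := Matrix.vecMul (fun j => ξ (X j)) (gram η X)⁻¹ with hc
  have hmem : ∑ i, c i • X i ∈ G := hX ▸ Submodule.sum_mem _ fun i _ =>
    Submodule.smul_mem _ _ (Submodule.subset_span ⟨i, rfl⟩)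
  have hu := (Matrix.isUnit_iff_isUnit_det _).1 (isUnit_gram hG hli hX)
  have h1 := hZ ξ _ hmem (forall_mem_span_range hX (ψ := flat η (∑ i, c i • X i)) fun j => by
    rw [flat_apply, apply_sum_eq_vecMul_gram, hc, Matrix.vecMul_vecMul,
      Matrix.nonsing_inv_mul _ hu, Matrix.vecMul_one])
  rw [← apply_sharp, h1, map_neg, map_sum]
  simp only [map_smul, smul_eq_mul]
  rfl

end LinearAlgebra

section Manifold

variable {E : Type*} [NormedAddCommGroup E] [NormedSpace ℝ E]
  {M : Type*} [TopologicalSpace M] [ChartedSpace E M] [IsManifold 𝓘(ℝ, E) ∞ M]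

/-- A smooth vector field is smooth in the coordinates of a chart. -/
theorem contDiffOn_chartDeriv_section {U : Set M} (hU : IsOpen U)
    {X : ∀ x : M, TangentSpace 𝓘(ℝ, E) x}
    (hX : ContMDiffOn 𝓘(ℝ, E) 𝓘(ℝ, E).tangent ∞
      (fun x => (⟨x, X x⟩ : TangentBundle 𝓘(ℝ, E) M)) U) (x₀ : M) :
    ContDiffOn ℝ ∞ (fun y => chartDeriv x₀ ((chartAt E x₀).symm y) (X ((chartAt E x₀).symm y)))
      ((chartAt E x₀).target ∩ (chartAt E x₀).symm ⁻¹' U) := by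
  have h1 := ((trivializationAt E (TangentSpace 𝓘(ℝ, E)) x₀).contMDiffOn_section_iff
    (n := ∞) (IB := 𝓘(ℝ, E)) (s := X)
    (hU.inter (trivializationAt E (TangentSpace 𝓘(ℝ, E)) x₀).open_baseSet)
    Set.inter_subset_right).1 (hX.mono Set.inter_subset_left)
  have h2 : ContMDiffOn 𝓘(ℝ, E) 𝓘(ℝ, E) ∞ (chartAt E x₀).symm
      ((chartAt E x₀).target ∩ (chartAt E x₀).symm ⁻¹' U) :=
    (contMDiffOn_chart_symm (I := 𝓘(ℝ, E)) (n := ∞) (x := x₀)).mono Set.inter_subset_left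
  have h3 := h1.comp h2 fun y hy => ⟨hy.2, (chartAt E x₀).map_target hy.1⟩
  refine (contMDiffOn_iff_contDiffOn.1 h3).congr fun y hy => ?_
  have hs := (chartAt E x₀).map_target hy.1
  have h4 := TangentBundle.continuousLinearMapAt_trivializationAt (I := 𝓘(ℝ, E)) hs
  have h5 := DFunLike.congr_fun h4 (X ((chartAt E x₀).symm y))
  refine Eq.trans ?_ (h5.symm.trans ?_)
  · rfl
  · exact congrFun (Bundle.Trivialization.coe_linearMapAt_of_mem _ hs) _

variable [FiniteDimensional ℝ E]

/-- The bivector field with `Z♯ = -(η|_G♯)⁻¹` is smooth: near a point it is given, in a smooth frame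
of `G`, by the inverse of the smooth Gram matrix of `η`. -/
theorem IsInducedBivector.isSmooth {η : FormField E M 2} (hη : η.IsSmooth)
    {G : TangentDistribution E M} (hG : G.IsSmooth) (hKG : ∀ x, IsCompl (kernel η x) (G x))
    {Z : MultiVectorField E M 2} (hZ : IsInducedBivector η G Z) : Z.IsSmooth := by
  intro x₀ y₀ hy₀
  obtain ⟨U, hU, hyU, r, X, hX, hXG⟩ := hG ((chartAt E x₀).symm y₀)
  set s := (chartAt E x₀).target ∩ (chartAt E x₀).symm ⁻¹' U with hs
  have hso : IsOpen s := (chartAt E x₀).isOpen_inter_preimage_symm hU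
  suffices h : ContDiffOn ℝ ∞ (Z.inChart x₀) s from
    (h.contDiffAt (hso.mem_nhds ⟨hy₀, hyU⟩)).contDiffWithinAt
  have hx : ∀ i, ContDiffOn ℝ ∞ (fun y => chartDeriv x₀ ((chartAt E x₀).symm y)
      (X i ((chartAt E x₀).symm y))) s := fun i => contDiffOn_chartDeriv_section hU (hX i) x₀
  have hg : ∀ i j, ContDiffOn ℝ ∞ (fun y => gram (η ((chartAt E x₀).symm y))
      (fun i => X i ((chartAt E x₀).symm y)) i j) s := by
    intro i j
    have h1 : ContDiffOn ℝ ∞ (fun y => curryTwo E (η.inChart x₀ y)) s :=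
      ((contDiff_curryTwo (W := E)).comp_contDiffOn (hη x₀)).mono Set.inter_subset_left
    refine ((h1.clm_apply (hx i)).clm_apply (hx j)).congr fun y hy => ?_
    rw [curryTwo_apply, FormField.inChart_apply_two, chartSymmDeriv_chartDeriv x₀ hy.1,
      chartSymmDeriv_chartDeriv x₀ hy.1]
    rfl
  have hu : ∀ y ∈ s, IsUnit (gram (η ((chartAt E x₀).symm y))
      (fun i => X i ((chartAt E x₀).symm y))) := fun y hy =>
    isUnit_gram (hKG _) (hXG _ hy.2).1 (hXG _ hy.2).2
  refine contDiffOn_alternating fun v => ?_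
  have hv : v = ![v 0, v 1] := by ext i : 1; fin_cases i <;> rfl
  have h2 : ContDiffOn ℝ ∞ (fun y => -∑ i, (∑ j, v 0 (chartDeriv x₀ ((chartAt E x₀).symm y)
      (X j ((chartAt E x₀).symm y))) * (gram (η ((chartAt E x₀).symm y))
      (fun i => X i ((chartAt E x₀).symm y)))⁻¹ j i) *
      v 1 (chartDeriv x₀ ((chartAt E x₀).symm y) (X i ((chartAt E x₀).symm y)))) s :=
    (ContDiffOn.sum fun i _ => (ContDiffOn.sum fun j _ =>
      ((v 0).contDiff.comp_contDiffOn (hx j)).mul (contDiffOn_inv_apply hg hu j i)).mul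
        ((v 1).contDiff.comp_contDiffOn (hx i))).neg
  refine h2.congr fun y hy => ?_
  rw [hv, MultiVectorField.inChart_apply_two,
    (hZ _).apply_eq_sum (hKG _) (hXG _ hy.2).1 (hXG _ hy.2).2]
  rfl

end Manifold

/-! ### Derivatives in charts -/

section Normed
variable {W : Type*} [NormedAddCommGroup W] [NormedSpace ℝ W]
  {X : Type*} [NormedAddCommGroup X] [NormedSpace ℝ X]

theorem continuousAlternating_swap (b : W [⋀^Fin 2]→L[ℝ] ℝ) (u v : W) :
    b ![v, u] = -b ![u, v] :=
  apply_swap b.toAlternatingMap u v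

theorem hasFDerivAt_curryTwo_apply {b : X → W [⋀^Fin 2]→L[ℝ] ℝ} {y₀ : X}
    (hb : DifferentiableAt ℝ b y₀) :
    HasFDerivAt (fun y => curryTwo W (b y)) ((curryTwo W).comp (fderiv ℝ b y₀)) y₀ := by
  have h : HasFDerivAt (curryTwo W) (curryTwo W) (b y₀) :=
    ContinuousLinearMap.hasFDerivAt (𝕜 := ℝ) (E := W [⋀^Fin 2]→L[ℝ] ℝ)
      (F := W →L[ℝ] W →L[ℝ] ℝ) (curryTwo W)
  exact HasFDerivAt.comp (g := curryTwo W) (g' := curryTwo W) y₀ h hb.hasFDerivAt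

variable [FiniteDimensional ℝ W]

theorem apply_sharpL_right (b : W [⋀^Fin 2]→L[ℝ] ℝ) (z : (W →L[ℝ] ℝ) [⋀^Fin 2]→L[ℝ] ℝ) (u : W)
    (ξ : W →L[ℝ] ℝ) : b ![u, sharpL W z ξ] = z ![ξ, curryTwo W b u] := by
  rw [← curryTwo_apply, apply_sharpL]

theorem hasFDerivAt_sharpL {z : X → (W →L[ℝ] ℝ) [⋀^Fin 2]→L[ℝ] ℝ} {y₀ : X}
    (hz : DifferentiableAt ℝ z y₀) :
    HasFDerivAt (fun y => sharpL W (z y)) ((sharpL W).comp (fderiv ℝ z y₀)) y₀ := by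
  have h : HasFDerivAt (sharpL W) (sharpL W) (z y₀) :=
    ContinuousLinearMap.hasFDerivAt (𝕜 := ℝ) (E := (W →L[ℝ] ℝ) [⋀^Fin 2]→L[ℝ] ℝ)
      (F := (W →L[ℝ] ℝ) →L[ℝ] W) (sharpL W)
  exact HasFDerivAt.comp (f := z) (f' := fderiv ℝ z y₀) (g := sharpL W) (g' := sharpL W) y₀ h
    hz.hasFDerivAt

/-- Let `f (A u, w) = b (u, w)` with `A = id + z♯ b♯`.  Then
`(∂_c f) (A p, A q) = (∂_c b) (p, q) + (∂_c z) (b♯ p, b♯ q)`. -/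
theorem fderiv_apply_idAddL {b f : X → W [⋀^Fin 2]→L[ℝ] ℝ}
    {z : X → (W →L[ℝ] ℝ) [⋀^Fin 2]→L[ℝ] ℝ} {y₀ : X} (hb : DifferentiableAt ℝ b y₀)
    (hf : DifferentiableAt ℝ f y₀) (hz : DifferentiableAt ℝ z y₀)
    (h : ∀ᶠ y in nhds y₀, ∀ u w, f y ![idAddL (z y) (b y) u, w] = b y ![u, w]) (c : X) (p q : W) :
    fderiv ℝ f y₀ c ![idAddL (z y₀) (b y₀) p, idAddL (z y₀) (b y₀) q] =
      fderiv ℝ b y₀ c ![p, q] +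
        fderiv ℝ z y₀ c ![curryTwo W (b y₀) p, curryTwo W (b y₀) q] := by
  have hb' := hasFDerivAt_curryTwo_apply hb
  have hf' := hasFDerivAt_curryTwo_apply hf
  have hz' := hasFDerivAt_sharpL hz
  have hbp := hb'.clm_apply (hasFDerivAt_const p y₀)
  have hA := (hz'.clm_apply hbp).const_add p
  have h1 := (hf'.clm_apply hA).clm_apply (hasFDerivAt_const (idAddL (z y₀) (b y₀) q) y₀)
  have h2 := hbp.clm_apply (hasFDerivAt_const (idAddL (z y₀) (b y₀) q) y₀)
  have h3 := h1.congr_of_eventuallyEq (f₁ := fun y => curryTwo W (b y) p (idAddL (z y₀) (b y₀) q))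
    (h.mono fun y hy =>
      (curryTwo_apply (b y) _ _).trans ((hy _ _).symm.trans (curryTwo_apply (f y) _ _).symm))
  -- both sides of `f (A p, A₀ q) = b (p, A₀ q)`, with `A₀` the value of `A` at `y₀`, differentiated
  have h4 := DFunLike.congr_fun (h3.unique h2) c
  have h0 : ∀ w, f y₀ ![w, idAddL (z y₀) (b y₀) q] = -curryTwo W (b y₀) q w := fun w => by
    rw [continuousAlternating_swap, h.self_of_nhds, curryTwo_apply]
  simp only [ContinuousLinearMap.comp_zero, zero_add, add_apply, ContinuousLinearMap.comp_apply,
    ContinuousLinearMap.flip_apply, map_add, curryTwo_apply _ _ (idAddL (z y₀) (b y₀) q), h0,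
    apply_sharpL] at h4
  rw [idAddL_apply _ _ p, ← curryTwo_apply, map_add, add_apply, curryTwo_apply, curryTwo_apply]
  have h5 : fderiv ℝ b y₀ c ![p, idAddL (z y₀) (b y₀) q] = fderiv ℝ b y₀ c ![p, q] -
      z y₀ ![curryTwo W (fderiv ℝ b y₀ c) p, curryTwo W (b y₀) q] := by
    rw [idAddL_apply, ← curryTwo_apply, map_add, apply_sharpL, curryTwo_apply,
      continuousAlternating_swap (z y₀) (curryTwo W (fderiv ℝ b y₀ c) p), sub_eq_add_neg]
  linarith

/-- The product rule for `z (b♯ p, b♯ q)`. -/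
theorem fderiv_bivector_curryTwo {b : X → W [⋀^Fin 2]→L[ℝ] ℝ}
    {z : X → (W →L[ℝ] ℝ) [⋀^Fin 2]→L[ℝ] ℝ} {y₀ : X} (hb : DifferentiableAt ℝ b y₀)
    (hz : DifferentiableAt ℝ z y₀) (c : X) (p q : W) :
    fderiv ℝ (fun y => z y ![curryTwo W (b y) p, curryTwo W (b y) q]) y₀ c =
      fderiv ℝ z y₀ c ![curryTwo W (b y₀) p, curryTwo W (b y₀) q] -
        fderiv ℝ b y₀ c ![p, sharpL W (z y₀) (curryTwo W (b y₀) q)] +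
        fderiv ℝ b y₀ c ![q, sharpL W (z y₀) (curryTwo W (b y₀) p)] := by
  have hb' := hasFDerivAt_curryTwo_apply hb
  have hz' := hasFDerivAt_curryTwo_apply hz
  have h1 := (hz'.clm_apply (hb'.clm_apply (hasFDerivAt_const p y₀))).clm_apply
    (hb'.clm_apply (hasFDerivAt_const q y₀))
  simp only [curryTwo_apply (W := W →L[ℝ] ℝ)] at h1
  rw [h1.fderiv]
  simp only [ContinuousLinearMap.comp_zero, zero_add, add_apply,
    ContinuousLinearMap.comp_apply, ContinuousLinearMap.flip_apply, curryTwo_apply (W := W →L[ℝ] ℝ),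
    apply_sharpL_right]
  rw [continuousAlternating_swap (z y₀) (curryTwo W (b y₀) q)]
  ring
end Normed

section Manifold

variable {E : Type*} [NormedAddCommGroup E] [NormedSpace ℝ E] [FiniteDimensional ℝ E]
  {M : Type*} [TopologicalSpace M] [ChartedSpace E M]

theorem sharpL_inChart_chartDeriv (P : MultiVectorField E M 2) (x₀ x : M)
    (hx : x ∈ (chartAt E x₀).source) (ξ : E →L[ℝ] ℝ) :
    sharpL E (P.inChart x₀ (chartAt E x₀ x)) ξ = chartDeriv x₀ x
      (sharp (P x) (ξ.toLinearMap ∘ₗ (chartDeriv x₀ x).toLinearMap)) := by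
  have h := sharpL_inChart P x₀ (chartAt E x₀ x) ξ
  have key : ∀ x', (chartAt E x₀).symm (chartAt E x₀ x) = x' →
      sharpL E (P.inChart x₀ (chartAt E x₀ x)) ξ = chartDeriv x₀ x'
      (sharp (P x') (ξ.toLinearMap ∘ₗ (chartDeriv x₀ x').toLinearMap)) := by
    rintro _ rfl
    exact h
  exact key x ((chartAt E x₀).left_inv hx)

theorem FormField.IsSmooth.differentiableAt {k : ℕ} {α : FormField E M k} (hα : α.IsSmooth)
    (x : M) : DifferentiableAt ℝ (α.inChart x) (chartAt E x x) :=
  ((hα x).contDiffAt ((chartAt E x).open_target.mem_nhds (mem_chart_target E x))).differentiableAt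
    (by norm_num)

theorem MultiVectorField.IsSmooth.differentiableAt {k : ℕ} {P : MultiVectorField E M k}
    (hP : P.IsSmooth) (x : M) : DifferentiableAt ℝ (P.inChart x) (chartAt E x x) :=
  ((hP x).contDiffAt ((chartAt E x).open_target.mem_nhds (mem_chart_target E x))).differentiableAt
    (by norm_num)

/-- The derivative of a form in a tangent direction `c`, taken in the chart around the point. -/
def chartDir {k : ℕ} (β : FormField E M k) (x : M) (c : TangentSpace 𝓘(ℝ, E) x) :
    TangentSpace 𝓘(ℝ, E) x [⋀^Fin k]→ₗ[ℝ] ℝ :=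
  (fderiv ℝ (β.inChart x) (chartAt E x x) (chartDeriv x x c)).toAlternatingMap.compLinearMap
    (chartDeriv x x).toLinearMap

theorem FormField.d_apply {k : ℕ} (α : FormField E M k) (x : M)
    (v : Fin (k + 1) → TangentSpace 𝓘(ℝ, E) x) :
    α.d x v = ∑ i : Fin (k + 1), (-1) ^ i.val * chartDir α x (v i) (i.removeNth v) := by
  have h : α.d x v = extDeriv (α.inChart x) (chartAt E x x) (fun i => chartDeriv x x (v i)) := rfl
  rw [h, extDeriv, ContinuousAlternatingMap.alternatizeUncurryFin_apply]
  simp only [zsmul_eq_mul]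
  push_cast
  rfl

theorem chartDir_apply (β : FormField E M 2) (x : M) (c u v : TangentSpace 𝓘(ℝ, E) x) :
    chartDir β x c ![u, v] = fderiv ℝ (β.inChart x) (chartAt E x x) (chartDeriv x x c)
      ![chartDeriv x x u, chartDeriv x x v] := by
  have h : chartDir β x c ![u, v] =
      fderiv ℝ (β.inChart x) (chartAt E x x) (chartDeriv x x c)
        (fun i => chartDeriv x x (![u, v] i)) := rfl
  rw [h]
  congr 1
  ext i
  fin_cases i <;> rfl

/-- The differential of a two-form as a cyclic sum of partial derivatives. -/
theorem FormField.d_apply_two (β : FormField E M 2) (x : M)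
    (u v w : TangentSpace 𝓘(ℝ, E) x) :
    β.d x ![u, v, w] = chartDir β x u ![v, w] + chartDir β x v ![w, u] +
      chartDir β x w ![u, v] := by
  rw [apply_swap (chartDir β x v) u w, FormField.d_apply, Fin.sum_univ_three]
  have h0 : (0 : Fin 3).removeNth ![u, v, w] = ![v, w] := by ext i; fin_cases i <;> rfl
  have h1 : (1 : Fin 3).removeNth ![u, v, w] = ![u, w] := by ext i; fin_cases i <;> rfl
  have h2 : (2 : Fin 3).removeNth ![u, v, w] = ![u, v] := by ext i; fin_cases i <;> rfl
  simp only [h0, h1, h2]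
  simp

variable [IsManifold 𝓘(ℝ, E) ∞ M]

theorem FormField.inChart_chartDeriv {k : ℕ} (α : FormField E M k) (x₀ x : M)
    (hx : x ∈ (chartAt E x₀).source) (v : Fin k → TangentSpace 𝓘(ℝ, E) x) :
    α.inChart x₀ (chartAt E x₀ x) (fun i => chartDeriv x₀ x (v i)) = α x v := by
  have key : ∀ y ∈ (chartAt E x₀).target, ∀ x', (chartAt E x₀).symm y = x' →
      ∀ v : Fin k → TangentSpace 𝓘(ℝ, E) x',
        α.inChart x₀ y (fun i => chartDeriv x₀ x' (v i)) = α x' v := by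
    rintro y hy _ rfl v
    rw [FormField.inChart_apply]
    congr 1
    exact funext fun i => chartSymmDeriv_chartDeriv x₀ hy _
  exact key _ ((chartAt E x₀).map_source hx) x ((chartAt E x₀).left_inv hx) v

theorem FormField.inChart_chartDeriv_two (α : FormField E M 2) (x₀ x : M)
    (hx : x ∈ (chartAt E x₀).source) (u v : TangentSpace 𝓘(ℝ, E) x) :
    α.inChart x₀ (chartAt E x₀ x) ![chartDeriv x₀ x u, chartDeriv x₀ x v] = α x ![u, v] := by
  rw [← α.inChart_chartDeriv x₀ x hx]
  congr 1
  ext i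
  fin_cases i <;> rfl

theorem curryTwo_inChart_comp_chartDeriv (β : FormField E M 2) (x₀ x : M)
    (hx : x ∈ (chartAt E x₀).source) (u : TangentSpace 𝓘(ℝ, E) x) :
    (curryTwo E (β.inChart x₀ (chartAt E x₀ x)) (chartDeriv x₀ x u)).toLinearMap ∘ₗ
      (chartDeriv x₀ x).toLinearMap = flat (β x) u := by
  ext w
  change curryTwo E (β.inChart x₀ (chartAt E x₀ x)) _ (chartDeriv x₀ x w) = _
  rw [curryTwo_apply, FormField.inChart_chartDeriv_two _ _ _ hx, flat_apply]

theorem sharpL_curryTwo_inChart (Z : MultiVectorField E M 2) (β : FormField E M 2) (x₀ x : M)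
    (hx : x ∈ (chartAt E x₀).source) (u : TangentSpace 𝓘(ℝ, E) x) :
    sharpL E (Z.inChart x₀ (chartAt E x₀ x))
      (curryTwo E (β.inChart x₀ (chartAt E x₀ x)) (chartDeriv x₀ x u)) =
      chartDeriv x₀ x (sharp (Z x) (flat (β x) u)) := by
  rw [sharpL_inChart_chartDeriv _ _ _ hx, curryTwo_inChart_comp_chartDeriv _ _ _ hx]

end Manifold

/-! ### The exterior square of a two-form and its contraction -/

section LinearAlgebra
variable {V : Type*} [AddCommGroup V] [Module ℝ V] [FiniteDimensional ℝ V]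

/-- The coordinate-free form `ι_Z β = ½ tr (Z♯ β♯)` of the contraction of a two-form. -/
theorem contract_two_eq_trace (Z : MultiVector 2 V) (β : V [⋀^Fin 2]→ₗ[ℝ] ℝ) (v : Fin 0 → V) :
    contract Z β v = 1 / 2 * LinearMap.trace ℝ V (sharp Z ∘ₗ flat β) := by
  have h : ∀ i, (Module.finBasis ℝ V).coord i (sharp Z (flat β (Module.finBasis ℝ V i))) =
      ∑ j, Z ![(Module.finBasis ℝ V).coord j, (Module.finBasis ℝ V).coord i] *
        β ![Module.finBasis ℝ V i, Module.finBasis ℝ V j] := by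
    intro i
    rw [apply_sharp, ← flat_apply]
    conv_lhs => rw [← sum_dual_smul_coord (flat β (Module.finBasis ℝ V i))]
    simp [mul_comm]
  have hv : v = ![] := Subsingleton.elim _ _
  rw [contract_apply, LinearMap.trace_eq_matrix_trace ℝ (Module.finBasis ℝ V), Matrix.trace,
    Finset.sum_comm, hv]
  congr 1
  refine Finset.sum_congr rfl fun i _ => ?_
  rw [Matrix.diag_apply, LinearMap.toMatrix_apply]
  exact (h i).symm

end LinearAlgebra

section Manifold

variable {E : Type*} [NormedAddCommGroup E] [NormedSpace ℝ E] [FiniteDimensional ℝ E]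
  {M : Type*} [TopologicalSpace M] [ChartedSpace E M]

theorem FormField.IsSmooth.contDiffOn_apply {k : ℕ} {α : FormField E M k} (hα : α.IsSmooth)
    (x₀ : M) (v : Fin k → E) :
    ContDiffOn ℝ ∞ (fun y => α.inChart x₀ y v) (chartAt E x₀).target := by
  have h : ContDiff ℝ ∞ (ContinuousAlternatingMap.apply ℝ E ℝ v) := by fun_prop
  exact h.comp_contDiffOn (hα x₀)

theorem chartDir_apply_eq_fderiv {k : ℕ} {α : FormField E M k} (hα : α.IsSmooth) (x : M)
    (c : TangentSpace 𝓘(ℝ, E) x) (v : Fin k → TangentSpace 𝓘(ℝ, E) x) :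
    chartDir α x c v = fderiv ℝ (fun y => α.inChart x y (fun i => chartDeriv x x (v i)))
      (chartAt E x x) (chartDeriv x x c) :=
  (fderiv_continuousAlternatingMap_apply_const_apply (hα.differentiableAt x) _ _).symm

theorem inChart_wedge_self (β : FormField E M 2) (x₀ : M) (y : E) (v : Fin 4 → E) :
    (β.wedge β).inChart x₀ y v = 2 * (β.inChart x₀ y ![v 0, v 1] * β.inChart x₀ y ![v 2, v 3] -
      β.inChart x₀ y ![v 0, v 2] * β.inChart x₀ y ![v 1, v 3] +
      β.inChart x₀ y ![v 0, v 3] * β.inChart x₀ y ![v 1, v 2]) := by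
  simp only [FormField.inChart_apply_two]
  exact wedge_two_two_self _ _

theorem FormField.IsSmooth.wedge_self {β : FormField E M 2} (hβ : β.IsSmooth) :
    (β.wedge β).IsSmooth := by
  intro x₀
  refine contDiffOn_alternating fun v => ?_
  simp only [inChart_wedge_self]
  have h := fun p q => hβ.contDiffOn_apply x₀ ![p, q]
  exact contDiffOn_const.mul ((((h _ _).mul (h _ _)).sub ((h _ _).mul (h _ _))).add
    ((h _ _).mul (h _ _)))

variable [IsManifold 𝓘(ℝ, E) ∞ M]

theorem chartDir_wedge_self {β : FormField E M 2} (hβ : β.IsSmooth) (x : M)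
    (c p q r s : TangentSpace 𝓘(ℝ, E) x) :
    chartDir (β.wedge β) x c ![p, q, r, s] =
      2 * (chartDir β x c ![p, q] * β x ![r, s] + β x ![p, q] * chartDir β x c ![r, s] -
        (chartDir β x c ![p, r] * β x ![q, s] + β x ![p, r] * chartDir β x c ![q, s]) +
        (chartDir β x c ![p, s] * β x ![q, r] + β x ![p, s] * chartDir β x c ![q, r])) := by
  rw [chartDir_apply_eq_fderiv hβ.wedge_self]
  have h : ∀ a b : TangentSpace 𝓘(ℝ, E) x, DifferentiableAt ℝ
      (fun y => β.inChart x y ![chartDeriv x x a, chartDeriv x x b]) (chartAt E x x) := fun a b =>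
    (hβ.differentiableAt x).continuousAlternatingMap_apply_const _
  have hd : ∀ a b : TangentSpace 𝓘(ℝ, E) x, fderiv ℝ
      (fun y => β.inChart x y ![chartDeriv x x a, chartDeriv x x b]) (chartAt E x x)
        (chartDeriv x x c) = chartDir β x c ![a, b] := fun a b => by
    rw [chartDir_apply]
    exact fderiv_continuousAlternatingMap_apply_const_apply (hβ.differentiableAt x) _ _
  have h0 : ∀ a b : TangentSpace 𝓘(ℝ, E) x, β.inChart x (chartAt E x x)
      ![chartDeriv x x a, chartDeriv x x b] = β x ![a, b] :=
    β.inChart_chartDeriv_two x x (mem_chart_source E x)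
  simp only [inChart_wedge_self]
  simp only [Matrix.cons_val_zero, Matrix.cons_val_one, Matrix.cons_val]
  have key := ((((h p q).hasFDerivAt.fun_mul (h r s).hasFDerivAt).fun_sub
    ((h p r).hasFDerivAt.fun_mul (h q s).hasFDerivAt)).fun_add
    ((h p s).hasFDerivAt.fun_mul (h q r).hasFDerivAt)).const_mul (2 : ℝ)
  rw [key.fderiv]
  simp only [add_apply, sub_apply, smul_apply, smul_eq_mul, hd, h0]
  ring

/-- The shuffle expansion of `d (β ∧ β) = 2 dβ ∧ β`. -/
theorem d_wedge_self_apply {β : FormField E M 2} (hβ : β.IsSmooth) (x : M)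
    (a b u v w : TangentSpace 𝓘(ℝ, E) x) :
    (β.wedge β).d x ![a, b, u, v, w] =
      2 * (β.d x ![a, b, u] * β x ![v, w] - β.d x ![a, b, v] * β x ![u, w] +
        β.d x ![a, b, w] * β x ![u, v] +
        β.d x ![a, u, v] * β x ![b, w] - β.d x ![a, u, w] * β x ![b, v] +
        β.d x ![a, v, w] * β x ![b, u] -
        β.d x ![b, u, v] * β x ![a, w] + β.d x ![b, u, w] * β x ![a, v] -
        β.d x ![b, v, w] * β x ![a, u] +
        β.d x ![u, v, w] * β x ![a, b]) := by
  have h0 : (0 : Fin 5).removeNth ![a, b, u, v, w] = ![b, u, v, w] := by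
    ext i; fin_cases i <;> rfl
  have h1 : (1 : Fin 5).removeNth ![a, b, u, v, w] = ![a, u, v, w] := by
    ext i; fin_cases i <;> rfl
  have h2 : (2 : Fin 5).removeNth ![a, b, u, v, w] = ![a, b, v, w] := by
    ext i; fin_cases i <;> rfl
  have h3 : (3 : Fin 5).removeNth ![a, b, u, v, w] = ![a, b, u, w] := by
    ext i; fin_cases i <;> rfl
  have h4 : (4 : Fin 5).removeNth ![a, b, u, v, w] = ![a, b, u, v] := by
    ext i; fin_cases i <;> rfl
  have hd : (β.wedge β).d x ![a, b, u, v, w] =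
      chartDir (β.wedge β) x a ![b, u, v, w] - chartDir (β.wedge β) x b ![a, u, v, w] +
      chartDir (β.wedge β) x u ![a, b, v, w] - chartDir (β.wedge β) x v ![a, b, u, w] +
      chartDir (β.wedge β) x w ![a, b, u, v] := by
    refine (FormField.d_apply (β.wedge β) x ![a, b, u, v, w]).trans
      ((Fin.sum_univ_five _).trans ?_)
    rw [h0, h1, h2, h3, h4]
    simp only [Matrix.cons_val_zero, Matrix.cons_val_one, Matrix.cons_val]
    norm_num
    ring
  rw [hd]
  simp only [chartDir_wedge_self hβ, FormField.d_apply_two]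
  have e : ∀ c p q, chartDir β x c ![q, p] = -chartDir β x c ![p, q] := fun c p q =>
    apply_swap _ _ _
  rw [e b a u, e b a v, e b a w, e u a v, e u a w, e v a w, e u b v, e u b w, e v b w, e v u w]
  ring

/-- In a chart `ι_Z β = ½ tr (A - id)` with `A = id + Z♯ β♯`. -/
theorem inChart_contract_two_eq_trace (Z : MultiVectorField E M 2) (β : FormField E M 2) (x₀ : M)
    {y : E} (hy : y ∈ (chartAt E x₀).target) (v : Fin 0 → E) :
    (β.contract Z).inChart x₀ y v = 1 / 2 * LinearMap.trace ℝ E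
      ((idAddL (Z.inChart x₀ y) (β.inChart x₀ y)).toLinearMap - LinearMap.id) := by
  let e := LinearEquiv.ofBijective (chartDeriv (E := E) x₀ ((chartAt E x₀).symm y)).toLinearMap
    (chartDeriv_bijective x₀ ((chartAt E x₀).map_target hy))
  have h1 : (β.contract Z).inChart x₀ y v = 1 / 2 * LinearMap.trace ℝ _
      (sharp (Z ((chartAt E x₀).symm y)) ∘ₗ flat (β ((chartAt E x₀).symm y))) :=
    contract_two_eq_trace _ _ _
  rw [h1, ← LinearMap.trace_conj' _ e]
  congr 2
  refine LinearMap.ext fun u => ?_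
  obtain ⟨v, rfl⟩ := e.surjective u
  have h2 := idAddL_inChart Z β x₀ hy v
  rw [idAdd_apply, map_add] at h2
  rw [LinearEquiv.conj_apply_apply, LinearEquiv.symm_apply_apply]
  change _ = idAddL (Z.inChart x₀ y) (β.inChart x₀ y) (chartDeriv x₀ _ v) - chartDeriv x₀ _ v
  rw [h2, add_sub_cancel_left]
  rfl

theorem FormField.IsSmooth.contract_two {Z : MultiVectorField E M 2} {β : FormField E M 2}
    (hZ : Z.IsSmooth) (hβ : β.IsSmooth) : (β.contract Z).IsSmooth := by
  intro x₀
  refine contDiffOn_alternating fun v => ?_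
  let T : (E →L[ℝ] E) →L[ℝ] ℝ := LinearMap.toContinuousLinearMap
    (LinearMap.trace ℝ E ∘ₗ ContinuousLinearMap.coeLM ℝ)
  have h : ContDiffOn ℝ ∞ (fun y => 1 / 2 * T (idAddL (Z.inChart x₀ y) (β.inChart x₀ y) -
      ContinuousLinearMap.id ℝ E)) (chartAt E x₀).target :=
    contDiffOn_const.mul (T.contDiff.comp_contDiffOn
      ((contDiffOn_idAddL_inChart hZ hβ x₀).sub contDiffOn_const))
  exact h.congr fun y hy => inChart_contract_two_eq_trace Z β x₀ hy v

theorem inChart_contract_wedge_self (Z : MultiVectorField E M 2) (β : FormField E M 2) (x₀ : M)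
    {y : E} (hy : y ∈ (chartAt E x₀).target) (v : Fin 2 → E) :
    ((β.wedge β).contract Z).inChart x₀ y v =
      2 * ((β.contract Z).inChart x₀ y ![] * β.inChart x₀ y v) +
      2 * Z.inChart x₀ y ![curryTwo E (β.inChart x₀ y) (v 0),
        curryTwo E (β.inChart x₀ y) (v 1)] := by
  have h : ∀ u : E, (curryTwo E (β.inChart x₀ y) u).toLinearMap ∘ₗ
      (chartDeriv x₀ ((chartAt E x₀).symm y)).toLinearMap =
      flat (β ((chartAt E x₀).symm y)) (chartSymmDeriv x₀ y u) := by
    intro u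
    ext w
    change curryTwo E (β.inChart x₀ y) u (chartDeriv x₀ _ w) = _
    rw [curryTwo_apply, FormField.inChart_apply_two, chartSymmDeriv_chartDeriv x₀ hy, flat_apply]
  have h0 : (β.contract Z).inChart x₀ y ![] =
      contract (Z ((chartAt E x₀).symm y)) (β ((chartAt E x₀).symm y)) ![] := by
    rw [FormField.inChart_apply]
    exact congrArg _ (Subsingleton.elim _ _)
  rw [MultiVectorField.inChart_apply_two, h, h, h0]
  exact contract_wedge_self _ _ _

theorem isSmooth_contract_wedge_self {Z : MultiVectorField E M 2} {β : FormField E M 2}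
    (hZ : Z.IsSmooth) (hβ : β.IsSmooth) : ((β.wedge β).contract Z).IsSmooth := by
  intro x₀
  refine contDiffOn_alternating fun v => ?_
  have hc : ContDiffOn ℝ ∞ (fun y => curryTwo E (β.inChart x₀ y)) (chartAt E x₀).target :=
    (contDiff_curryTwo (W := E)).comp_contDiffOn (hβ x₀)
  have hz : ContDiffOn ℝ ∞ (fun y => curryTwo (E →L[ℝ] ℝ) (Z.inChart x₀ y))
      (chartAt E x₀).target :=
    (contDiff_curryTwo (W := E →L[ℝ] ℝ)).comp_contDiffOn (hZ x₀)
  have h : ContDiffOn ℝ ∞ (fun y =>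
      2 * ((β.contract Z).inChart x₀ y ![] * β.inChart x₀ y v) +
      2 * curryTwo (E →L[ℝ] ℝ) (Z.inChart x₀ y) (curryTwo E (β.inChart x₀ y) (v 0))
        (curryTwo E (β.inChart x₀ y) (v 1))) (chartAt E x₀).target :=
    (contDiffOn_const.mul (((FormField.IsSmooth.contract_two hZ hβ).contDiffOn_apply x₀ _).mul
      (hβ.contDiffOn_apply x₀ v))).add (contDiffOn_const.mul
      ((hz.clm_apply (hc.clm_apply contDiffOn_const)).clm_apply (hc.clm_apply contDiffOn_const)))
  refine h.congr fun y hy => ?_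
  rw [inChart_contract_wedge_self Z β x₀ hy, curryTwo_apply (W := E →L[ℝ] ℝ)]

/-- The derivative of the bivector field `Z` in a tangent direction `c`, taken in the chart around
the point and evaluated on the covectors `β♯ v`, `β♯ w`. -/
def bivectorDir (Z : MultiVectorField E M 2) (β : FormField E M 2) (x : M)
    (c v w : TangentSpace 𝓘(ℝ, E) x) : ℝ :=
  fderiv ℝ (Z.inChart x) (chartAt E x x) (chartDeriv x x c)
    ![curryTwo E (β.inChart x (chartAt E x x)) (chartDeriv x x v),
      curryTwo E (β.inChart x (chartAt E x x)) (chartDeriv x x w)]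

theorem chartDir_contract_wedge_self {Z : MultiVectorField E M 2} {β : FormField E M 2}
    (hZ : Z.IsSmooth) (hβ : β.IsSmooth) (x : M) (c v w : TangentSpace 𝓘(ℝ, E) x) :
    chartDir ((β.wedge β).contract Z) x c ![v, w] =
      2 * (chartDir (β.contract Z) x c ![] * β x ![v, w] +
        contract (Z x) (β x) ![] * chartDir β x c ![v, w]) +
      2 * (bivectorDir Z β x c v w - chartDir β x c ![v, sharp (Z x) (flat (β x) w)] +
        chartDir β x c ![w, sharp (Z x) (flat (β x) v)]) := by
  have hx := mem_chart_source E x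
  have hs := isSmooth_contract_wedge_self hZ hβ
  have hg := FormField.IsSmooth.contract_two hZ hβ
  rw [chartDir_apply_eq_fderiv hs]
  have hev : (fun y => ((β.wedge β).contract Z).inChart x y
      (fun i => chartDeriv x x (![v, w] i))) =ᶠ[nhds (chartAt E x x)] fun y =>
      2 * ((β.contract Z).inChart x y ![] *
        β.inChart x y ![chartDeriv x x v, chartDeriv x x w]) +
      2 * Z.inChart x y ![curryTwo E (β.inChart x y) (chartDeriv x x v),
        curryTwo E (β.inChart x y) (chartDeriv x x w)] := by
    filter_upwards [(chartAt E x).open_target.mem_nhds (mem_chart_target E x)] with y hy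
    rw [inChart_contract_wedge_self Z β x hy]
    have : (fun i => chartDeriv x x (![v, w] i)) = ![chartDeriv x x v, chartDeriv x x w] := by
      ext i; fin_cases i <;> rfl
    rw [this]
    rfl
  have h1 : DifferentiableAt ℝ (fun y => (β.contract Z).inChart x y ![]) (chartAt E x x) :=
    (hg.differentiableAt x).continuousAlternatingMap_apply_const _
  have h2 : DifferentiableAt ℝ (fun y => β.inChart x y ![chartDeriv x x v, chartDeriv x x w])
      (chartAt E x x) := (hβ.differentiableAt x).continuousAlternatingMap_apply_const _
  have h3 : DifferentiableAt ℝ (fun y => Z.inChart x y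
      ![curryTwo E (β.inChart x y) (chartDeriv x x v),
        curryTwo E (β.inChart x y) (chartDeriv x x w)]) (chartAt E x x) := by
    have hb' := hasFDerivAt_curryTwo_apply (hβ.differentiableAt x)
    have hz' := hasFDerivAt_curryTwo_apply (hZ.differentiableAt x)
    have := ((hz'.clm_apply (hb'.clm_apply (hasFDerivAt_const (chartDeriv x x v) _))).clm_apply
      (hb'.clm_apply (hasFDerivAt_const (chartDeriv x x w) _))).differentiableAt
    simpa only [curryTwo_apply (W := E →L[ℝ] ℝ)] using this
  have key := ((h1.hasFDerivAt.fun_mul h2.hasFDerivAt).const_mul (2 : ℝ)).fun_add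
    (h3.hasFDerivAt.const_mul (2 : ℝ))
  have e1 : fderiv ℝ (fun y => (β.contract Z).inChart x y ![]) (chartAt E x x)
      (chartDeriv x x c) = chartDir (β.contract Z) x c ![] := by
    rw [chartDir_apply_eq_fderiv hg]
    congr 3
    ext y
    exact congrArg _ (Subsingleton.elim _ _)
  have e2 : fderiv ℝ (fun y => β.inChart x y ![chartDeriv x x v, chartDeriv x x w])
      (chartAt E x x) (chartDeriv x x c) = chartDir β x c ![v, w] := by
    rw [chartDir_apply]
    exact fderiv_continuousAlternatingMap_apply_const_apply (hβ.differentiableAt x) _ _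
  have e3 : (β.contract Z).inChart x (chartAt E x x) ![] = contract (Z x) (β x) ![] := by
    have := (β.contract Z).inChart_chartDeriv x x hx ![]
    rw [← show (β.contract Z) x ![] = contract (Z x) (β x) ![] from rfl, ← this]
    exact congrArg _ (Subsingleton.elim _ _)
  rw [hev.fderiv_eq, key.fderiv]
  simp only [add_apply, smul_apply, smul_eq_mul]
  rw [fderiv_bivector_curryTwo (hβ.differentiableAt x) (hZ.differentiableAt x), e1, e2, e3,
    FormField.inChart_chartDeriv_two _ _ _ hx, sharpL_curryTwo_inChart _ _ _ _ hx,
    sharpL_curryTwo_inChart _ _ _ _ hx, ← chartDir_apply, ← chartDir_apply]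
  rw [bivectorDir]
  ring

end Manifold

/-! ### The Maurer–Cartan expression -/

section Manifold

variable {E : Type*} [NormedAddCommGroup E] [NormedSpace ℝ E] [FiniteDimensional ℝ E]
  {M : Type*} [TopologicalSpace M] [ChartedSpace E M]

theorem bivectorDir_add (Z : MultiVectorField E M 2) (β : FormField E M 2) (x : M)
    (c c' v w : TangentSpace 𝓘(ℝ, E) x) :
    bivectorDir Z β x (c + c') v w = bivectorDir Z β x c v w + bivectorDir Z β x c' v w := by
  simp only [bivectorDir, map_add]
  rfl

theorem chartDir_add (β : FormField E M 2) (x : M) (c c' u v : TangentSpace 𝓘(ℝ, E) x) :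
    chartDir β x (c + c') ![u, v] = chartDir β x c ![u, v] + chartDir β x c' ![u, v] := by
  simp only [chartDir_apply, map_add]
  rfl

/-- The Schouten square of a bivector field on `E` as a cyclic sum. -/
theorem schoutenE_self_apply (z : E → (E →L[ℝ] ℝ) [⋀^Fin 2]→L[ℝ] ℝ) (y : E)
    (ξ₀ ξ₁ ξ₂ : E →L[ℝ] ℝ) :
    schoutenE z z y ![ξ₀, ξ₁, ξ₂] = 2 * (fderiv ℝ z y (sharpL E (z y) ξ₀) ![ξ₁, ξ₂] +
      fderiv ℝ z y (sharpL E (z y) ξ₁) ![ξ₂, ξ₀] + fderiv ℝ z y (sharpL E (z y) ξ₂) ![ξ₀, ξ₁]) := by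
  have hs : ∀ ξ : E →L[ℝ] ℝ, sharp ((z y).toAlternatingMap.compLinearMap
      LinearMap.toContinuousLinearMap.toLinearMap) (ξ : E →ₗ[ℝ] ℝ) = sharpL E (z y) ξ := by
    intro ξ
    refine eq_of_forall_dual_eq fun ζ => ?_
    rw [apply_sharpL]
    refine (apply_sharp _ (ξ : E →ₗ[ℝ] ℝ) (ζ : E →ₗ[ℝ] ℝ)).trans ?_
    change z y (fun i => LinearMap.toContinuousLinearMap (![(ξ : E →ₗ[ℝ] ℝ), ζ] i)) = _
    congr 1
    ext i : 1
    fin_cases i <;> rfl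
  have hb : ∀ ξ : E →L[ℝ] ℝ, ∀ v : Fin 2 → E →L[ℝ] ℝ,
      bivectorDeriv z z y ξ v = fderiv ℝ z y (sharpL E (z y) ξ) v := by
    intro ξ v
    rw [← hs]
    rfl
  have h0 : (0 : Fin 3).removeNth ![ξ₀, ξ₁, ξ₂] = ![ξ₁, ξ₂] := by
    ext i : 1; fin_cases i <;> rfl
  have h1 : (1 : Fin 3).removeNth ![ξ₀, ξ₁, ξ₂] = ![ξ₀, ξ₂] := by
    ext i : 1; fin_cases i <;> rfl
  have h2 : (2 : Fin 3).removeNth ![ξ₀, ξ₁, ξ₂] = ![ξ₀, ξ₁] := by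
    ext i : 1; fin_cases i <;> rfl
  rw [schoutenE, AlternatingMap.alternatizeUncurryFin_apply, Fin.sum_univ_three, h0, h1, h2,
    continuousAlternating_swap _ ξ₀ ξ₂]
  simp only [LinearMap.add_apply, AlternatingMap.add_apply, hb]
  simp
  ring

theorem d_contract_two_apply {Z : MultiVectorField E M 2} (β : FormField E M 2) (x : M)
    (u : TangentSpace 𝓘(ℝ, E) x) :
    (β.contract Z).d x ![u] = chartDir (β.contract Z) x u ![] := by
  refine (FormField.d_apply (β.contract Z) x ![u]).trans ?_
  simp

variable [IsManifold 𝓘(ℝ, E) ∞ M]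

/-- `½ [Z, Z] (β♯ u, β♯ v, β♯ w)` is the cyclic sum of `(∂_{Z♯ β♯ u} Z) (β♯ v, β♯ w)`. -/
theorem half_schouten_self_apply (Z : MultiVectorField E M 2) (β : FormField E M 2) (x : M)
    (u v w : TangentSpace 𝓘(ℝ, E) x) :
    ((1 / 2 : ℝ) • schouten Z Z x) ![flat (β x) u, flat (β x) v, flat (β x) w] =
      bivectorDir Z β x (sharp (Z x) (flat (β x) u)) v w +
      bivectorDir Z β x (sharp (Z x) (flat (β x) v)) w u +
      bivectorDir Z β x (sharp (Z x) (flat (β x) w)) u v := by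
  have hx := mem_chart_source E x
  have hc : ∀ u, LinearMap.toContinuousLinearMap
      ((chartDeriv (E := E) x x).inverse.toLinearMap.dualMap (flat (β x) u)) =
      curryTwo E (β.inChart x (chartAt E x x)) (chartDeriv x x u) := by
    intro u
    ext w
    obtain ⟨w, rfl⟩ := (chartDeriv_bijective x hx).2 w
    have hi : (chartDeriv (E := E) x x).inverse (chartDeriv x x w) = w := by
      have : T2Space (TangentSpace 𝓘(ℝ, E) x) := inferInstanceAs (T2Space E)
      let e := (LinearEquiv.ofBijective (chartDeriv (E := E) x x).toLinearMap
        (chartDeriv_bijective x hx)).toContinuousLinearEquiv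
      have he : chartDeriv (E := E) x x = e.toContinuousLinearMap := by ext; rfl
      rw [he, ContinuousLinearMap.inverse_equiv]
      exact e.symm_apply_apply w
    change flat (β x) u ((chartDeriv (E := E) x x).inverse (chartDeriv x x w)) = _
    rw [hi, curryTwo_apply, FormField.inChart_chartDeriv_two _ _ _ hx, flat_apply]
  have h : schouten Z Z x ![flat (β x) u, flat (β x) v, flat (β x) w] =
      schoutenE (Z.inChart x) (Z.inChart x) (chartAt E x x)
        ![curryTwo E (β.inChart x (chartAt E x x)) (chartDeriv x x u),
          curryTwo E (β.inChart x (chartAt E x x)) (chartDeriv x x v),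
          curryTwo E (β.inChart x (chartAt E x x)) (chartDeriv x x w)] := by
    rw [← hc, ← hc, ← hc, schouten, AlternatingMap.compLinearMap_apply]
    congr 1
    ext i : 1
    fin_cases i <;> rfl
  rw [AlternatingMap.smul_apply, h, schoutenE_self_apply, sharpL_curryTwo_inChart _ _ _ _ hx,
    sharpL_curryTwo_inChart _ _ _ _ hx, sharpL_curryTwo_inChart _ _ _ _ hx, smul_eq_mul]
  simp only [bivectorDir]
  ring

theorem idAddL_inChart_chartDeriv (Z : MultiVectorField E M 2) (β : FormField E M 2) (x : M)
    (v : TangentSpace 𝓘(ℝ, E) x) :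
    idAddL (Z.inChart x (chartAt E x x)) (β.inChart x (chartAt E x x)) (chartDeriv x x v) =
      chartDeriv x x (idAdd (Z x) (β x) v) := by
  rw [idAddL_apply, sharpL_curryTwo_inChart _ _ _ _ (mem_chart_source E x), idAdd_apply, map_add]

/-- The differential of `F β` on vectors `A u, A v, A w` with `A = id + Z♯ β♯`, from
`fderiv_apply_idAddL` in the chart around `x`. -/
theorem d_FField_apply {Z : MultiVectorField E M 2} {β : FormField E M 2}
    (hZ : Z.IsSmooth) (hβ : β ∈ sectionsIZ Z) (x : M) (u v w : TangentSpace 𝓘(ℝ, E) x) :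
    (FField Z β).d x ![idAdd (Z x) (β x) u, idAdd (Z x) (β x) v, idAdd (Z x) (β x) w] =
      (chartDir β x (idAdd (Z x) (β x) u) ![v, w] + bivectorDir Z β x (idAdd (Z x) (β x) u) v w) +
      (chartDir β x (idAdd (Z x) (β x) v) ![w, u] + bivectorDir Z β x (idAdd (Z x) (β x) v) w u) +
      (chartDir β x (idAdd (Z x) (β x) w) ![u, v] +
        bivectorDir Z β x (idAdd (Z x) (β x) w) u v) := by
  have h : ∀ c p q, chartDir (FField Z β) x c ![idAdd (Z x) (β x) p, idAdd (Z x) (β x) q] =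
      chartDir β x c ![p, q] + bivectorDir Z β x c p q := by
    intro c p q
    rw [chartDir_apply, chartDir_apply, ← idAddL_inChart_chartDeriv, ← idAddL_inChart_chartDeriv]
    refine fderiv_apply_idAddL (hβ.1.differentiableAt x)
      ((isSmooth_FField hZ hβ.1 hβ.2).differentiableAt x) (hZ.differentiableAt x) ?_ _ _ _
    filter_upwards [(chartAt E x).open_target.mem_nhds (mem_chart_target E x)] with y hy
    exact inChart_FField_apply hβ.2 x hy
  rw [FormField.d_apply_two, h, h, h]

/-- `½ λ₂ (β, β)` is the cyclic sum of `(∂_{Z♯ β♯ u} β) (v, w) + (∂_u Z) (β♯ v, β♯ w)`. -/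
theorem lambda₂_self_apply {Z : MultiVectorField E M 2} {β : FormField E M 2}
    (hZ : Z.IsSmooth) (hβ : β.IsSmooth) (x : M) (u v w : TangentSpace 𝓘(ℝ, E) x) :
    (lambda₂ Z β β : FormField E M 3) x ![u, v, w] =
      2 * ((chartDir β x (sharp (Z x) (flat (β x) u)) ![v, w] + bivectorDir Z β x u v w) +
        (chartDir β x (sharp (Z x) (flat (β x) v)) ![w, u] + bivectorDir Z β x v w u) +
        (chartDir β x (sharp (Z x) (flat (β x) w)) ![u, v] + bivectorDir Z β x w u v)) := by
  have hl : ∀ a, (lieBivector Z β : FormField E M 1) x ![a] =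
      contract (Z x) (β.d x) ![a] - chartDir (β.contract Z) x a ![] := by
    intro a
    rw [← d_contract_two_apply]
    rfl
  have h1 : (((lieBivector Z β : FormField E M 1).wedge β).reindex 3 : FormField E M 3)
      x ![u, v, w] =
      wedge ((lieBivector Z β : FormField E M 1) x) (β x) ![u, v, w] := by
    simp only [FormField.reindex, reindex]
    rfl
  have h2 : ((β.wedge (lieBivector Z β : FormField E M 1)).reindex 3 : FormField E M 3)
      x ![u, v, w] =
      wedge (β x) ((lieBivector Z β : FormField E M 1) x) ![u, v, w] := by
    simp only [FormField.reindex, reindex]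
    rfl
  have h3 : (lieBivector Z (β.wedge β) : FormField E M 3) x ![u, v, w] =
      contract (Z x) ((β.wedge β).d x) ![u, v, w] - ((β.wedge β).contract Z).d x ![u, v, w] := rfl
  have h4 : (lambda₂ Z β β : FormField E M 3) x ![u, v, w] =
      (-1 : ℝ) ^ 2 * ((-1 : ℝ) ^ 3 * ((lieBivector Z (β.wedge β) : FormField E M 3) x ![u, v, w] -
        (((lieBivector Z β : FormField E M 1).wedge β).reindex 3 : FormField E M 3) x ![u, v, w] -
        (-1 : ℝ) ^ 2 * ((β.wedge (lieBivector Z β : FormField E M 1)).reindex 3 : FormField E M 3)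
          x ![u, v, w])) := rfl
  rw [h4, h1, h2, h3, wedge_one_two, wedge_two_one, FormField.d_apply_two,
    contract_of_eq_two_wedge (Z x) (β x) (β.d x) _ (d_wedge_self_apply hβ x)]
  simp only [Matrix.cons_val_zero, Matrix.cons_val_one, Matrix.cons_val, hl,
    chartDir_contract_wedge_self hZ hβ, FormField.d_apply_two]
  have e : ∀ c p q, chartDir β x c ![q, p] = -chartDir β x c ![p, q] := fun c p q =>
    apply_swap _ _ _
  rw [e _ u (sharp (Z x) _), e _ v (sharp (Z x) _), e _ w (sharp (Z x) _)]
  ring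

/-- The left-hand side of the Maurer–Cartan equation of `β` is the pull-back of
the differential of `F β` by the bundle automorphism `id + Z♯ β♯`. -/
theorem maurerCartan_apply {Z : MultiVectorField E M 2} {β : FormField E M 2}
    (hZ : Z.IsSmooth) (hβ : β ∈ sectionsIZ Z) (x : M) (u v w : TangentSpace 𝓘(ℝ, E) x) :
    (lambda₁ β + (1 / 2 : ℝ) • (lambda₂ Z β β : FormField E M 3) +
      (1 / 6 : ℝ) • (lambda₃ Z β β β : FormField E M 3)) x ![u, v, w] =
    (FField Z β).d x ![idAdd (Z x) (β x) u, idAdd (Z x) (β x) v, idAdd (Z x) (β x) w] := by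
  have h : (lambda₁ β + (1 / 2 : ℝ) • (lambda₂ Z β β : FormField E M 3) +
      (1 / 6 : ℝ) • (lambda₃ Z β β β : FormField E M 3)) x ![u, v, w] =
      β.d x ![u, v, w] + (1 / 2 : ℝ) * (lambda₂ Z β β : FormField E M 3) x ![u, v, w] +
      (1 / 6 : ℝ) * ((-1 : ℝ) ^ 3 * (sharpWedgeTri (β x) (β x) (β x)
        ((1 / 2 : ℝ) • schouten Z Z x) : TangentSpace 𝓘(ℝ, E) x [⋀^Fin 3]→ₗ[ℝ] ℝ)
          ![u, v, w]) := rfl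
  rw [h, lambda₂_self_apply hZ hβ.1, sharpWedgeTri_self, half_schouten_self_apply,
    FormField.d_apply_two, d_FField_apply hZ hβ]
  simp only [idAdd_apply, chartDir_add, bivectorDir_add]
  ring

end Manifold

/-! ### Maurer–Cartan elements and pre-symplectic forms -/

section Manifold

variable {E : Type*} [NormedAddCommGroup E] [NormedSpace ℝ E]
  {M : Type*} [TopologicalSpace M] [ChartedSpace E M]

theorem isHorizontal_two_iff (η β : FormField E M 2) : IsHorizontal η β ↔
    ∀ x, ∀ u ∈ kernel η x, ∀ v ∈ kernel η x, β x ![u, v] = 0 := by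
  refine forall_congr' fun x => ⟨fun h u hu v hv => h _ ?_, fun h v hv => ?_⟩
  · intro i
    fin_cases i
    exacts [hu, hv]
  · rw [show v = ![v 0, v 1] by ext i : 1; fin_cases i <;> rfl]
    exact h _ (hv 0) _ (hv 1)

variable [FiniteDimensional ℝ E]

theorem FormField.IsSmooth.add {k : ℕ} {α β : FormField E M k} (hα : α.IsSmooth)
    (hβ : β.IsSmooth) : (α + β).IsSmooth :=
  fun x₀ => contDiffOn_alternating fun v =>
    (hα.contDiffOn_apply x₀ v).add (hβ.contDiffOn_apply x₀ v)

theorem FormField.IsSmooth.sub {k : ℕ} {α β : FormField E M k} (hα : α.IsSmooth)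
    (hβ : β.IsSmooth) : (α - β).IsSmooth :=
  fun x₀ => contDiffOn_alternating fun v =>
    (hα.contDiffOn_apply x₀ v).sub (hβ.contDiffOn_apply x₀ v)

theorem MultiVectorField.IsSmooth.neg {p : ℕ} {P : MultiVectorField E M p} (hP : P.IsSmooth) :
    (-P).IsSmooth :=
  fun x₀ => (hP x₀).neg

theorem FormField.d_add {k : ℕ} {α β : FormField E M k} (hα : α.IsSmooth) (hβ : β.IsSmooth) :
    (α + β).d = α.d + β.d := by
  funext x
  have h : (α + β).inChart x = α.inChart x + β.inChart x := rfl
  rw [FormField.d, h, extDeriv_add (hα.differentiableAt x) (hβ.differentiableAt x)]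
  rfl

theorem expη_eq_add (η : FormField E M 2) (Z : MultiVectorField E M 2) (β : FormField E M 2) :
    expη η Z β = η + FField Z β := rfl

variable [IsManifold 𝓘(ℝ, E) ∞ M]

theorem maurerCartan_iff_d_FField_eq_zero {Z : MultiVectorField E M 2} {β : FormField E M 2}
    (hZ : Z.IsSmooth) (hβ : β ∈ sectionsIZ Z) :
    lambda₁ β + (1 / 2 : ℝ) • (lambda₂ Z β β : FormField E M 3) +
      (1 / 6 : ℝ) • (lambda₃ Z β β β : FormField E M 3) = 0 ↔ (FField Z β).d = 0 := by
  have ext_vec : ∀ α : FormField E M 3, α = 0 ↔ ∀ x u v w, α x ![u, v, w] = 0 := by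
    refine fun α => ⟨fun h x u v w => by rw [h]; rfl, fun h => funext fun x => ?_⟩
    ext v
    rw [show v = ![v 0, v 1, v 2] by ext i : 1; fin_cases i <;> rfl]
    exact h x _ _ _
  rw [ext_vec, ext_vec]
  refine forall_congr' fun x => ?_
  simp only [maurerCartan_apply hZ hβ]
  have hs := idAdd_surjective (hβ.2 x)
  exact ⟨fun h u v w => by
    obtain ⟨u, rfl⟩ := hs u
    obtain ⟨v, rfl⟩ := hs v
    obtain ⟨w, rfl⟩ := hs w
    exact h u v w, fun h u v w => h _ _ _⟩

/-- Horizontality of `β` amounts to `exp_η β` having the rank of `η`, and the Maurer–Cartan equation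
to `exp_η β` being closed. -/
theorem mem_MC_iff_isPreSymplectic_expη {k : ℕ} {η : FormField E M 2} (hη : IsPreSymplectic η k)
    {G : TangentDistribution E M} (hG : ∀ x, IsCompl (kernel η x) (G x))
    {Z : MultiVectorField E M 2} (hZ : IsInducedBivector η G Z) (hZs : Z.IsSmooth)
    {β : FormField E M 2} (hβ : β ∈ sectionsIZ Z) :
    β ∈ MC η Z ↔ IsPreSymplectic (expη η Z β) k := by
  have hF := isSmooth_FField hZs hβ.1 hβ.2
  have hd : (expη η Z β).d = (FField Z β).d := by
    rw [expη_eq_add, FormField.d_add hη.isSmooth hF, hη.closed, zero_add]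
  have hr : IsHorizontal η β ↔
      ∀ x, Module.finrank ℝ (LinearMap.range (flat (expη η Z β x))) = k := by
    refine (isHorizontal_two_iff η β).trans (forall_congr' fun x => ?_)
    rw [← hη.rank x]
    exact (finrank_range_diracExp_iff (hG x) (hZ x) (hβ.2 x)).symm
  constructor
  · rintro ⟨-, hh, hMC⟩
    exact ⟨hη.isSmooth.add hF, hd.trans ((maurerCartan_iff_d_FField_eq_zero hZs hβ).1 hMC),
      hr.1 hh⟩
  · intro h
    exact ⟨hβ.1, hr.2 h.rank, (maurerCartan_iff_d_FField_eq_zero hZs hβ).2 (hd.symm.trans h.closed)⟩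

/-- The preimage of `η'` is `F_{-Z} (η' - η)`. -/
theorem exists_expη_eq {k : ℕ} {η : FormField E M 2} (hη : IsPreSymplectic η k)
    {G : TangentDistribution E M} (hG : ∀ x, IsCompl (kernel η x) (G x))
    {Z : MultiVectorField E M 2} (hZ : IsInducedBivector η G Z) (hZs : Z.IsSmooth)
    {η' : FormField E M 2} (hη' : η'.IsSmooth) (hG' : ∀ x, IsCompl (kernel η' x) (G x)) :
    ∃ β ∈ sectionsIZ Z, expη η Z β = η' := by
  have hI : ∀ x, (η' - η) x ∈ IZ ((-Z) x) := fun x => sub_mem_IZ_neg (hG x) (hZ x) (hG' x)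
  refine ⟨FField (-Z) (η' - η), ⟨isSmooth_FField hZs.neg (hη'.sub hη.isSmooth) hI, fun x => ?_⟩,
    funext fun x => ?_⟩
  · have h := F_mem_IZ_neg (hI x)
    rwa [Pi.neg_apply, neg_neg] at h
  · have h := F_neg_F (hI x)
    rw [Pi.neg_apply, neg_neg] at h
    change η x + F (Z x) (F (-Z x) ((η' - η) x)) = η' x
    rw [h, Pi.sub_apply, add_sub_cancel]

end Manifold

end PreSymplectic

end

open PreSymplectic

theorem theorem2p11 {E : Type*} [NormedAddCommGroup E] [NormedSpace ℝ E] [FiniteDimensional ℝ E]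
    {M : Type*} [TopologicalSpace M] [ChartedSpace E M] [IsManifold 𝓘(ℝ, E) ∞ M]
    (k : ℕ) (η : FormField E M 2) (hη : IsPreSymplectic η k)
    (G : TangentDistribution E M) (hG : G.IsSmooth) (hKG : ∀ x, IsCompl (kernel η x) (G x)) :
    (∃! Z : MultiVectorField E M 2, IsInducedBivector η G Z) ∧
    ∀ Z : MultiVectorField E M 2, IsInducedBivector η G Z →
      Z.IsSmooth ∧
      (∀ β ∈ sectionsIZ Z, β ∈ MC η Z ↔ IsPreSymplectic (expη η Z β) k) ∧
      Set.BijOn (expη η Z) (sectionsIZ Z ∩ MC η Z)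
        {η' | IsPreSymplectic η' k ∧ ∀ x, IsCompl (kernel η' x) (G x)} := by
  constructor
  · choose Z hZ using fun x => exists_isNegInverse (hKG x)
    exact ⟨Z, hZ, fun Z' hZ' => funext fun x => (hZ' x).unique (hKG x) (hZ x)⟩
  intro Z hZ
  have hZs := IsInducedBivector.isSmooth hη.isSmooth hG hKG hZ
  have hMC : ∀ β ∈ sectionsIZ Z, β ∈ MC η Z ↔ IsPreSymplectic (expη η Z β) k :=
    fun β hβ => mem_MC_iff_isPreSymplectic_expη hη hKG hZ hZs hβ
  refine ⟨hZs, hMC, ?_, ?_, ?_⟩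
  · rintro β ⟨hβ, hm⟩
    exact ⟨(hMC β hβ).1 hm, fun x => isCompl_ker_diracExp (hKG x) (hZ x) (hβ.2 x)
      ((isHorizontal_two_iff η β).1 hm.2.1 x)⟩
  · rintro β ⟨hβ, -⟩ β' ⟨hβ', -⟩ h
    funext x
    have hF : F (Z x) (β x) = F (Z x) (β' x) := add_left_cancel (congrFun h x)
    rw [← F_neg_F (hβ.2 x), hF, F_neg_F (hβ'.2 x)]
  · rintro η' ⟨hη', hG'⟩
    obtain ⟨β, hβ, rfl⟩ := exists_expη_eq hη hKG hZ hZs hη'.isSmooth hG'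
    exact ⟨β, ⟨hβ, (hMC β hβ).2 hη'⟩, rfl⟩
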